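/- Let $d\ge 1$, let $M\in\mathbb R^{d\times d}$, and let $S\subseteq\{1,\dots,d\}^2$ be the set of observed positions. For $\theta=(A,B)$ with $A,B\in\mathbb R^{d\times d}$ (identified with a vector in $\mathbb R^{2d^2}$ with its Euclidean structure) let $$R_S(\theta)=\frac1{|S|}\sum_{(i,j)\in S}\big((AB)_{ij}-M_{ij}\big)^2,$$ let $\delta M$ be the residual matrix, $\delta M_{ij}=(AB)_{ij}-M_{ij}$ for $(i,j)\in S$ and $\delta M_{ij}=0$ otherwise, and let $W_{\rm aug}(\theta)=\begin{bmatrix}A\\ B^\top\end{bmatrix}\in\mathbb R^{2d\times d}$. For linearly independent $\alpha_1,\dots,\alpha_k\in\mathbb R^d$, the $\Omega_k$ invariant manifold $\Omega_k(\alpha_1,\dots,\alpha_k)$ is the set of all $(A,B)$ such that every row of $A$ and every column of $B$ lies in $\mathrm{span}\{\alpha_1,\dots,\alpha_k\}$. Consider the bipartite graph on row and column indices in which $i$ and $j$ are adjacent iff $(i,j)\in S$, with its isolated vertices removed. For a connected component $L$ of this graph, the sub-$\Omega_k$ invariant manifold of $L$ is the set of those $(A,B)\in\Omega_k(\alpha_1,\dots,\alpha_k)$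 for which the rows of $A$ and the columns of $B$ with index not in $L$ are zero. Let $0\le k<d$, let $\Omega$ be an $\Omega_k$ or a sub-$\Omega_k$ invariant manifold, and let $\theta_c\in\Omega$. Assume: (1) the largest singular value of the residual $\delta M$ at $\theta_c$ is unique, in the sense that the largest eigenvalue of $\begin{bmatrix}0&-\delta M\\-\delta M^\top&0\end{bmatrix}$ has multiplicity one (in particular $\delta M\ne0$); (2) $\theta_c$ is a second-order stationary point within $\Omega$: $\nabla R_S(\theta_c)=0$ and $\theta^\top\nabla^2R_S(\theta_c)\,\theta\ge0$ for all $\theta\in\Omega$. Let $\lambda_1$ be the largest eigenvalue of $-\nabla^2R_S(\theta_c)$. Then the gradient flow $\dot\theta=-\nabla R_S(\theta)$ has a solution $t\mapsto\varphi(\theta_0,t)$ on $[0,\infty)$ from every initial point $\theta_0$, and for Lebesgue-almost every $\theta_0\in\mathbb R^{2d^2}$ the limit $$\tilde\varphi(t)=\lim_{\alpha\to0^+}\varphi\Big(\theta_c+\alpha\theta_0,\;t+\frac1{\lambda_1}\log\frac1\alpha\Big)$$ exists for every $t\in\mathbb R$, and there are linearly independent $\beta_1,\dots,\beta_{k+1}\in\mathbb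 R^d$ with $\tilde\varphi(t)\in\Omega_{k+1}(\beta_1,\dots,\beta_{k+1})$ for all $t\in\mathbb R$. Moreover the rank goes up by exactly one: $\operatorname{rank}W_{\rm aug}(\tilde\varphi(t))=\operatorname{rank}W_{\rm aug}(\theta_c)+1$ for all $t\in\mathbb R$, and for all sufficiently negative $t$ the two factors of $\tilde\varphi(t)$ have ranks $\operatorname{rank}A_c+1$ and $\operatorname{rank}B_c+1$, where $\theta_c=(A_c,B_c)$. -/

import Mathlib

open Filter Topology MeasureTheory
open scoped Matrix

noncomputable section

/-- The parameters `θ = (A, B)`, vectorized: a point of `ℝ^{2d²}` with its Euclidean structure.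
The left summand indexes the entries of `A`, the right one those of `B`. -/
abbrev Param (d : ℕ) : Type :=
  EuclideanSpace ℝ ((Fin d × Fin d) ⊕ (Fin d × Fin d))

/-- The factor `A` of `θ = (A, B)`. -/
def factorA {d : ℕ} (θ : Param d) : Matrix (Fin d) (Fin d) ℝ :=
  Matrix.of fun i j => θ (Sum.inl (i, j))

/-- The factor `B` of `θ = (A, B)`. -/
def factorB {d : ℕ} (θ : Param d) : Matrix (Fin d) (Fin d) ℝ :=
  Matrix.of fun i j => θ (Sum.inr (i, j))

/-- The augmented matrix: the rows of `A` on top of the (transposed) columns of `B`. -/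
def augMatrix {d : ℕ} (θ : Param d) : Matrix (Fin d ⊕ Fin d) (Fin d) ℝ :=
  Matrix.fromRows (factorA θ) (factorB θ)ᵀ

/-- The empirical risk: the mean squared error of `A * B` over the set `S` of observed positions. -/
def risk {d : ℕ} (S : Finset (Fin d × Fin d)) (M : Matrix (Fin d) (Fin d) ℝ) (θ : Param d) : ℝ :=
  (1 / (S.card : ℝ)) * ∑ p ∈ S, ((factorA θ * factorB θ) p.1 p.2 - M p.1 p.2) ^ 2

/-- The residual matrix: `A * B - M` on the observed positions, `0` elsewhere. -/
def residualMatrix {d : ℕ} (S : Finset (Fin d × Fin d)) (M : Matrix (Fin d) (Fin d) ℝ) (θ : Param d) :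
    Matrix (Fin d) (Fin d) ℝ :=
  Matrix.of fun i j => if (i, j) ∈ S then (factorA θ * factorB θ) i j - M i j else 0

/-- The Hessian of `f` at `x`, as an operator: the derivative of the gradient. -/
def hessian {E : Type*} [NormedAddCommGroup E] [InnerProductSpace ℝ E] [CompleteSpace E]
    (f : E → ℝ) (x : E) : E →L[ℝ] E :=
  fderiv ℝ (gradient f) x

/-- `γ` solves the gradient flow `γ' = -∇f(γ)` on `[0, ∞)` with `γ 0 = x`. -/
def IsGradientFlowFrom {E : Type*} [NormedAddCommGroup E] [InnerProductSpace ℝ E] [CompleteSpace E]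
    (f : E → ℝ) (x : E) (γ : ℝ → E) : Prop :=
  γ 0 = x ∧ ∀ t : ℝ, 0 ≤ t → HasDerivWithinAt γ (-gradient f (γ t)) (Set.Ici 0) t

open Classical in
/-- The gradient flow `φ(x, t)` of `f`: the value at time `t ≥ 0` of the solution that starts
at `x`. (The value is arbitrary if there is no solution on `[0, ∞)`, and at negative times.) -/
def gradFlow {E : Type*} [NormedAddCommGroup E] [InnerProductSpace ℝ E] [CompleteSpace E]
    (f : E → ℝ) (x : E) (t : ℝ) : E :=
  if h : ∃ γ : ℝ → E, IsGradientFlowFrom f x γ then h.choose t else 0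

/-- The invariant manifold generated by `α 0, …, α (k - 1)`: the pairs `(A, B)` such that every row
of `A` and every column of `B` lies in the span of these vectors. -/
def Omega {d k : ℕ} (α : Fin k → Fin d → ℝ) : Set (Param d) :=
  {θ | (∀ i, factorA θ i ∈ Submodule.span ℝ (Set.range α)) ∧
    ∀ j, (factorB θ)ᵀ j ∈ Submodule.span ℝ (Set.range α)}

/-- The bipartite graph of the observed positions: row `i` and column `j` are adjacent if and only
if `(i, j)` is observed. -/
def bipartiteGraph {d : ℕ} (S : Finset (Fin d × Fin d)) : SimpleGraph (Fin d ⊕ Fin d) :=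
  SimpleGraph.fromRel fun u v => ∃ i j, (i, j) ∈ S ∧ u = Sum.inl i ∧ v = Sum.inr j

/-- The associated observation graph: the bipartite graph with its isolated vertices removed. -/
def observationGraph {d : ℕ} (S : Finset (Fin d × Fin d)) :
    SimpleGraph (bipartiteGraph S).support :=
  (bipartiteGraph S).induce (bipartiteGraph S).support

/-- The row indices in a connected component of the observation graph. -/
def compRows {d : ℕ} {S : Finset (Fin d × Fin d)}
    (L : (observationGraph S).ConnectedComponent) : Set (Fin d) :=
  {i | ∃ h : Sum.inl i ∈ (bipartiteGraph S).support,
    (observationGraph S).connectedComponentMk ⟨Sum.inl i, h⟩ = L}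

/-- The column indices in a connected component of the observation graph. -/
def compCols {d : ℕ} {S : Finset (Fin d × Fin d)}
    (L : (observationGraph S).ConnectedComponent) : Set (Fin d) :=
  {j | ∃ h : Sum.inr j ∈ (bipartiteGraph S).support,
    (observationGraph S).connectedComponentMk ⟨Sum.inr j, h⟩ = L}

/-- The sub-manifold of `Omega α` that belongs to the connected component `L`: the rows of `A` and
the columns of `B` whose index is not in `L` vanish. -/
def subOmega {d k : ℕ} {S : Finset (Fin d × Fin d)}
    (L : (observationGraph S).ConnectedComponent) (α : Fin k → Fin d → ℝ) : Set (Param d) :=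
  {θ | θ ∈ Omega α ∧ (∀ i, i ∉ compRows L → factorA θ i = 0) ∧
    ∀ j, j ∉ compCols L → (factorB θ)ᵀ j = 0}

/-- `Ω` is an `Ω_k` invariant manifold or a sub-`Ω_k` invariant manifold. -/
def IsRankInvariantManifold {d : ℕ} (S : Finset (Fin d × Fin d)) (k : ℕ)
    (Ω : Set (Param d)) : Prop :=
  ∃ α : Fin k → Fin d → ℝ, LinearIndependent ℝ α ∧
    (Ω = Omega α ∨ ∃ L : (observationGraph S).ConnectedComponent, Ω = subOmega L α)

/-- The largest singular value of `D` is unique: the largest eigenvalue of the symmetric matrix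
`[[0, -D], [-Dᵀ, 0]]`, whose eigenvalues are `±` the singular values of `D`, has multiplicity one.
(This excludes `D = 0`.) -/
def UniqueTopSingularValue {d : ℕ} (D : Matrix (Fin d) (Fin d) ℝ) : Prop :=
  ∃ σ : ℝ,
    IsGreatest {μ : ℝ | Module.End.HasEigenvalue
      (Matrix.toLin' (Matrix.fromBlocks 0 (-D) (-Dᵀ) 0)) μ} σ ∧
    Module.finrank ℝ (Module.End.eigenspace
      (Matrix.toLin' (Matrix.fromBlocks 0 (-D) (-Dᵀ) 0)) σ) = 1

/-- `x` is a second-order stationary point of `f` within `Ω`: the gradient vanishes at `x`, and the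
quadratic form of the Hessian at `x` is nonnegative on `Ω`. -/
def IsSecondOrderStationaryWithin {E : Type*} [NormedAddCommGroup E] [InnerProductSpace ℝ E]
    [CompleteSpace E] (f : E → ℝ) (Ω : Set E) (x : E) : Prop :=
  gradient f x = 0 ∧ ∀ v ∈ Ω, 0 ≤ inner ℝ v (hessian f x v)

/-- `μ` is the largest (real) eigenvalue of the operator `T`. -/
def IsTopEigenvalue {E : Type*} [NormedAddCommGroup E] [InnerProductSpace ℝ E]
    (T : E →L[ℝ] E) (μ : ℝ) : Prop :=
  IsGreatest {ν : ℝ | Module.End.HasEigenvalue (T : E →ₗ[ℝ] E) ν} μ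

end

/-! Write L = -∇²R(θ_c), with top eigenvalue λ, eigenspace W, orthogonal projection P onto W, and
gap μ to the rest of the spectrum. The substitution α = e^{λσ} turns the limit into σ → -∞ for
trajectories released at time σ from θ_c + e^{λσ}θ₀. Near θ_c the flow is linear up to a quadratic
remainder: the W-component at time t is e^{λt}Pθ₀ + O(e^{2λt}), and the rest is smaller than e^{λt}
by a factor e^{-μ(t-σ)} + O(e^{λt}). Barrier estimates make this uniform in σ. Two trajectories with
the same Pθ₀, released early enough, differ at time s by O(e^{2λs}) and then separate at rate at
most 3λ/2 < 2λ, so they merge as s → -∞. The limit z is therefore an entire trajectory that depends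
only on Pθ₀ and leaves θ_c in the direction Pθ₀ (`IsSemiflow.exists_escape_limit`).

The top eigenspace is explicit. Up to the factor 2/|S|, the quadratic form of L is that of the
dilation of δM, summed over the columns of the augmented matrix, minus a nonnegative square
(`sum_col_dotProduct_smul_one_sub`). Hence λ ≤ 2σ/|S|, where σ is now the top singular value.
Equality is attained at (p, q) ⊗ w with w orthogonal to the rows of A_c and the columns of B_c, and
such w ≠ 0 exists because k < d. Since σ is simple, every top eigenvector has the form (p, q) ⊗ w
(`exists_eq_rankOneParam`).

So Pθ₀ = (p, q) ⊗ w, and w lies outside the span of α unless θ₀ is in a proper linear subspace, a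
null set. Having all rows of A and columns of B in a fixed subspace is preserved by the flow in both
time directions (`IsSemiflow.sub_mem_iff`). This confines z to the span of α and w and bounds the
augmented rank from above. From below, z - θ_c is to leading order (p, q) ⊗ w, where w is a new row
direction and p, q are orthogonal to the columns of A_c and B_cᵀ, so each rank jumps for very
negative t (`eventually_rank_add_one_le`). For the augmented matrix the jump persists because its
row space cannot shrink along the flow.

The upper bound for the separate factors has two cases. If the residual is nonzero somewhere on the
block that belongs to Ω, the second-order condition makes both factors injective on the span of α,
so they already have rank at least k. Otherwise p and q vanish on the block, and z only adds
multiples of w to rows and columns outside it. -/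

noncomputable section

/-! ### Barrier estimates and the length of gradient curves. -/

section Barrier

variable {E : Type*} [NormedAddCommGroup E] [InnerProductSpace ℝ E]

/-- A fencing estimate: a curve that points strictly inwards whenever its norm touches the positive
barrier `m` stays below that barrier. -/
theorem norm_le_of_inner_lt_barrier {x x' : ℝ → E} {m m' : ℝ → ℝ} {a b : ℝ}
    (hx : ∀ t ∈ Set.Icc a b, HasDerivWithinAt x (x' t) (Set.Ici a) t)
    (hm : ∀ t, HasDerivAt m (m' t) t) (hpos : ∀ t, 0 < m t) (ha : ‖x a‖ ≤ m a)
    (hlt : ∀ t ∈ Set.Icc a b, ‖x t‖ = m t → inner ℝ (x t) (x' t) < m t * m' t) :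
    ∀ t ∈ Set.Icc a b, ‖x t‖ ≤ m t := by
  have hsq : ∀ t ∈ Set.Icc a b, ‖x t‖ ^ 2 ≤ m t ^ 2 := by
    refine image_le_of_deriv_right_lt_deriv_boundary (f' := fun t => 2 * inner ℝ (x t) (x' t))
      (B' := fun t => 2 * (m t * m' t)) ?_ ?_ ?_ ?_ ?_
    · intro t ht
      exact ((hx t ht).norm_sq.continuousWithinAt).mono Set.Icc_subset_Ici_self
    · intro t ht
      exact ((hx t ⟨ht.1, ht.2.le⟩).norm_sq).mono (Set.Ici_subset_Ici.2 ht.1)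
    · gcongr
    · intro t
      exact ((hm t).pow 2).congr_deriv (by simp only [Nat.cast_ofNat]; ring)
    · intro t ht h
      have h1 : ‖x t‖ = m t := by
        have := abs_eq_abs.2 (sq_eq_sq_iff_eq_or_eq_neg.1 h)
        rwa [abs_of_nonneg (norm_nonneg _), abs_of_pos (hpos t)] at this
      have := hlt t ⟨ht.1, ht.2.le⟩ h1
      simpa using this
  intro t ht
  exact le_of_sq_le_sq (hsq t ht) (hpos t).le

theorem contDiff_gradient [CompleteSpace E] {f : E → ℝ} {n : WithTop ℕ∞}
    (hf : ContDiff ℝ (n + 1) f) : ContDiff ℝ n (gradient f) :=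
  (InnerProductSpace.toDual ℝ E).symm.contDiff.comp (hf.fderiv_right le_rfl)

/-- The distance travelled by a damped gradient flow of a nonnegative function. -/
theorem norm_sub_le_of_damped_gradient_flow [CompleteSpace E] {f : E → ℝ} (hf : Differentiable ℝ f)
    (hf0 : ∀ x, 0 ≤ f x) {η : E → ℝ} (hη : ∀ x, 0 ≤ η x ∧ η x ≤ 1) {γ : ℝ → E} {T : ℝ}
    (hγ : ∀ t ∈ Set.Icc 0 T,
      HasDerivWithinAt γ (η (γ t) • -gradient f (γ t)) (Set.Icc 0 T) t) :
    ∀ t ∈ Set.Icc 0 T, ‖γ t - γ 0‖ ≤ T + f (γ 0) := by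
  have hfγ : ∀ t ∈ Set.Icc 0 T, HasDerivWithinAt (fun s => f (γ s))
      (-(η (γ t) * ‖gradient f (γ t)‖ ^ 2)) (Set.Icc 0 T) t := by
    intro t ht
    refine (((hf (γ t)).hasGradientAt.hasFDerivAt).comp_hasDerivWithinAt t (hγ t ht)).congr_deriv ?_
    rw [InnerProductSpace.toDual_apply_apply, inner_smul_right, inner_neg_right,
      real_inner_self_eq_norm_sq]
    ring
  -- The speed satisfies η‖∇f‖ ≤ 1 + η‖∇f‖², and the last term is the rate at which the energy
  -- drops; integrating bounds the distance by elapsed time plus energy lost.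
  have hmain := image_norm_le_of_norm_deriv_right_le_deriv_boundary' (a := 0) (b := T)
    (f := fun t => γ t - γ 0) (f' := fun t => η (γ t) • -gradient f (γ t))
    (B := fun t => t + (f (γ 0) - f (γ t))) (B' := fun t => 1 + η (γ t) * ‖gradient f (γ t)‖ ^ 2)
    (fun t ht => ((hγ t ht).sub_const _).continuousWithinAt)
    (fun t ht => ((hγ t ⟨ht.1, ht.2.le⟩).mono_of_mem_nhdsWithin
      (Icc_mem_nhdsGE_of_mem ht)).sub_const _)
    (by simp)
    (fun t ht => (((hasDerivWithinAt_id t _).add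
      ((hfγ t ht).const_sub _))).continuousWithinAt)
    (fun t ht => by
      have := ((hasDerivWithinAt_id t (Set.Ici t)).add
        (((hfγ t ⟨ht.1, ht.2.le⟩).mono_of_mem_nhdsWithin (Icc_mem_nhdsGE_of_mem ht)).const_sub
          (f (γ 0))))
      rw [neg_neg] at this
      exact this)
    (fun t ht => by
      obtain ⟨h0, h1⟩ := hη (γ t)
      rw [norm_smul, norm_neg, Real.norm_of_nonneg h0]
      nlinarith [mul_nonneg h0 (sq_nonneg (‖gradient f (γ t)‖ - 1)),
        mul_nonneg h0 (sq_nonneg (‖gradient f (γ t)‖))])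
  intro t ht
  have : ‖γ t - γ 0‖ ≤ t + (f (γ 0) - f (γ t)) := hmain ht
  have h1 := hf0 (γ t)
  have h2 := ht.2
  linarith

end Barrier

/-! ### Global existence and uniqueness for the gradient flow. -/

section Existence

variable {E : Type*} [NormedAddCommGroup E] [InnerProductSpace ℝ E] [FiniteDimensional ℝ E]

theorem exists_lipschitzOnWith_closedBall {F : Type*} [NormedAddCommGroup F] [NormedSpace ℝ F]
    {g : E → F} (hg : ContDiff ℝ 1 g) (R : ℝ) :
    ∃ K, LipschitzOnWith K g (Metric.closedBall 0 R) :=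
  hg.contDiffOn.exists_lipschitzOnWith one_ne_zero (convex_closedBall 0 R)
    (isCompact_closedBall 0 R)

/-- A field bounded by `L` moves a point by at most `L * T`, so a single application of
Picard–Lindelöf on that ball covers all of `[0, T]`. -/
theorem exists_solution_of_lipschitz_of_bounded {v : E → E} {K L : NNReal}
    (hv : LipschitzWith K v) (hL : ∀ x, ‖v x‖ ≤ L) (x : E) {T : ℝ} (hT : 0 ≤ T) :
    ∃ γ : ℝ → E, γ 0 = x ∧ ∀ t ∈ Set.Icc 0 T, HasDerivWithinAt γ (v (γ t)) (Set.Icc 0 T) t := by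
  have := FiniteDimensional.complete ℝ E
  have hPL : IsPicardLindelof (fun _ => v) (tmin := 0) (tmax := T) ⟨0, le_rfl, hT⟩ x
      (L * T.toNNReal) 0 L K :=
    { lipschitzOnWith := fun _ _ => hv.lipschitzOnWith
      continuousOn := fun _ _ => continuousOn_const
      norm_le := fun _ _ y _ => hL y
      mul_max_le := by simp [hT] }
  exact hPL.exists_eq_forall_mem_Icc_hasDerivWithinAt₀

theorem eqOn_of_solutions {g : E → E} (hg : ContDiff ℝ 1 g) {γ δ : ℝ → E} {T : ℝ}
    (hγ : ∀ t ∈ Set.Icc 0 T, HasDerivWithinAt γ (g (γ t)) (Set.Icc 0 T) t)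
    (hδ : ∀ t ∈ Set.Icc 0 T, HasDerivWithinAt δ (g (δ t)) (Set.Icc 0 T) t)
    (h0 : γ 0 = δ 0) : Set.EqOn γ δ (Set.Icc 0 T) := by
  have hγc : ContinuousOn γ (Set.Icc 0 T) := fun t ht => (hγ t ht).continuousWithinAt
  have hδc : ContinuousOn δ (Set.Icc 0 T) := fun t ht => (hδ t ht).continuousWithinAt
  obtain ⟨R₁, hR₁⟩ := isCompact_Icc.exists_bound_of_continuousOn hγc
  obtain ⟨R₂, hR₂⟩ := isCompact_Icc.exists_bound_of_continuousOn hδc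
  obtain ⟨K, hK⟩ := exists_lipschitzOnWith_closedBall hg (max R₁ R₂)
  have key : ∀ {η : ℝ → E},
      (∀ t ∈ Set.Icc 0 T, HasDerivWithinAt η (g (η t)) (Set.Icc 0 T) t) →
      ∀ t ∈ Set.Ico 0 T, HasDerivWithinAt η (g (η t)) (Set.Ici t) t := fun h t ht =>
    (h t ⟨ht.1, ht.2.le⟩).mono_of_mem_nhdsWithin (Icc_mem_nhdsGE_of_mem ht)
  refine ODE_solution_unique_of_mem_Icc_right (v := fun _ => g)
    (s := fun _ => Metric.closedBall 0 (max R₁ R₂)) (K := K) (fun _ _ => hK) hγc (key hγ) ?_ hδc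
    (key hδ) ?_ h0
  · intro t ht
    simpa using Or.inl (hR₁ t ⟨ht.1, ht.2.le⟩)
  · intro t ht
    simpa using Or.inr (hR₂ t ⟨ht.1, ht.2.le⟩)

/-- Damping the field by a bump makes it bounded and Lipschitz. The length estimate also holds for
the damped flow and keeps the curve within `T + f x` of `x`, where the bump equals 1 and the damping
is invisible. -/
theorem exists_gradient_flow_Icc [CompleteSpace E] {f : E → ℝ} (hf : ContDiff ℝ 2 f)
    (hf0 : ∀ x, 0 ≤ f x) (x : E) {T : ℝ} (hT : 0 ≤ T) :
    ∃ γ : ℝ → E, γ 0 = x ∧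
      ∀ t ∈ Set.Icc 0 T, HasDerivWithinAt γ (-gradient f (γ t)) (Set.Icc 0 T) t := by
  have hpos : 0 < T + f x + 1 := by linarith [hf0 x]
  let η : ContDiffBump x := ⟨T + f x + 1, T + f x + 2, hpos, by linarith⟩
  have hcd : ContDiff ℝ 1 fun y => η y • -gradient f y :=
    η.contDiff.smul (contDiff_gradient (n := 1) (by simpa [one_add_one_eq_two] using hf)).neg
  have hcs : HasCompactSupport fun y => η y • -gradient f y := η.hasCompactSupport.smul_right
  obtain ⟨K, hK⟩ := hcd.lipschitzWith_of_hasCompactSupport hcs one_ne_zero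
  obtain ⟨L, hL⟩ := hcs.exists_bound_of_continuous hcd.continuous
  obtain ⟨γ, hγ0, hγ⟩ := exists_solution_of_lipschitz_of_bounded hK (L := L.toNNReal)
    (fun y => (hL y).trans (Real.le_coe_toNNReal L)) x hT
  have hb := norm_sub_le_of_damped_gradient_flow (hf.differentiable two_ne_zero) hf0 (η := η)
    (fun y => ⟨η.nonneg, η.le_one⟩) hγ
  refine ⟨γ, hγ0, fun t ht => ?_⟩
  have h1 : η (γ t) = 1 := by
    apply η.one_of_mem_closedBall
    have := hb t ht
    rw [hγ0] at this
    rw [mem_closedBall_iff_norm]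
    change _ ≤ T + f x + 1
    linarith
  simpa [h1] using hγ t ht

theorem exists_isGradientFlowFrom [CompleteSpace E] {f : E → ℝ} (hf : ContDiff ℝ 2 f)
    (hf0 : ∀ x, 0 ≤ f x) (x : E) : ∃ γ : ℝ → E, IsGradientFlowFrom f x γ := by
  have hg : ContDiff ℝ 1 fun y => -gradient f y :=
    (contDiff_gradient (n := 1) (by simpa [one_add_one_eq_two] using hf)).neg
  choose γ hγ0 hγ using fun n : ℕ => exists_gradient_flow_Icc hf hf0 x (T := n) n.cast_nonneg
  have hagree : ∀ m n : ℕ, m ≤ n → ∀ t ∈ Set.Icc (0 : ℝ) m, γ m t = γ n t := by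
    intro m n hmn
    have hsub : Set.Icc (0 : ℝ) m ⊆ Set.Icc (0 : ℝ) n :=
      Set.Icc_subset_Icc_right (by exact_mod_cast hmn)
    exact eqOn_of_solutions hg (hγ m) (fun t ht => (hγ n t (hsub ht)).mono hsub)
      (by rw [hγ0, hγ0])
  have heq : ∀ (n : ℕ), ∀ t ∈ Set.Ico (0 : ℝ) n, γ (⌊t⌋₊ + 1) t = γ n t := by
    intro n t ht
    refine hagree _ _ ?_ t ⟨ht.1, by push_cast; exact (Nat.lt_floor_add_one t).le⟩
    exact Nat.succ_le_of_lt ((Nat.floor_lt ht.1).2 ht.2)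
  -- The solution with index `⌊t⌋₊ + 1` lives strictly beyond `t`; by `heq` the glued curve agrees
  -- with `γ n` on `[0, n)`.
  refine ⟨fun t => γ (⌊t⌋₊ + 1) t, by simp [hγ0], fun t ht => ?_⟩
  obtain ⟨n, hn⟩ := exists_nat_gt t
  have h1 : HasDerivWithinAt (γ n) (-gradient f (γ n t)) (Set.Ici 0) t :=
    (hγ n t ⟨ht, hn.le⟩).mono_of_mem_nhdsWithin
      (mem_nhdsWithin.2 ⟨Set.Iio n, isOpen_Iio, hn, fun s hs => ⟨hs.2, le_of_lt hs.1⟩⟩)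
  have h2 : (fun t => γ (⌊t⌋₊ + 1) t) =ᶠ[𝓝[Set.Ici 0] t] γ n :=
    mem_nhdsWithin.2 ⟨Set.Iio n, isOpen_Iio, hn, fun s hs => heq n s ⟨hs.2, hs.1⟩⟩
  simp only [heq n t ⟨ht, hn⟩]
  exact h1.congr_of_eventuallyEq h2 (heq n t ⟨ht, hn⟩)

end Existence

/-! ### Semiflows: semigroup law, continuity, invariant affine subspaces. -/

section Semiflow

variable {E : Type*} [NormedAddCommGroup E] [InnerProductSpace ℝ E]

/-- `φ x` solves `γ' = g γ` on `[0, ∞)` from `x`, and `φ` is bounded on bounded sets of initial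
points and times. -/
structure IsSemiflow (g : E → E) (φ : E → ℝ → E) : Prop where
  zero : ∀ x, φ x 0 = x
  deriv : ∀ x t, 0 ≤ t → HasDerivWithinAt (φ x) (g (φ x t)) (Set.Ici 0) t
  bounded : ∀ r T : ℝ, ∃ R, ∀ x, ‖x‖ ≤ r → ∀ t ∈ Set.Icc 0 T, ‖φ x t‖ ≤ R

theorem isGradientFlowFrom_gradFlow [FiniteDimensional ℝ E] [CompleteSpace E] {f : E → ℝ}
    (hf : ContDiff ℝ 2 f) (hf0 : ∀ x, 0 ≤ f x) (x : E) :
    IsGradientFlowFrom f x (gradFlow f x) := by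
  have h := exists_isGradientFlowFrom hf hf0 x
  have : gradFlow f x = h.choose := by
    funext t
    simp only [gradFlow, dif_pos h]
  rw [this]
  exact h.choose_spec

theorem isSemiflow_gradFlow [FiniteDimensional ℝ E] [CompleteSpace E] {f : E → ℝ}
    (hf : ContDiff ℝ 2 f) (hf0 : ∀ x, 0 ≤ f x) :
    IsSemiflow (fun x => -gradient f x) (gradFlow f) := by
  have hsol := isGradientFlowFrom_gradFlow hf hf0
  refine ⟨fun x => (hsol x).1, fun x => (hsol x).2, fun r T => ?_⟩
  obtain ⟨C, hC⟩ := (isCompact_closedBall (0 : E) r).exists_bound_of_continuousOn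
    hf.continuous.continuousOn
  refine ⟨r + (T + C), fun x hx t ht => ?_⟩
  have h := norm_sub_le_of_damped_gradient_flow (hf.differentiable two_ne_zero) hf0
    (η := fun _ => 1) (γ := gradFlow f x) (T := T) (fun _ => ⟨zero_le_one, le_rfl⟩)
    (fun t ht => by
      simpa using ((hsol x).2 t ht.1).mono Set.Icc_subset_Ici_self) t ht
  rw [(hsol x).1] at h
  have h1 := hC x (by simpa using hx)
  have h2 := le_abs_self (f x)
  rw [Real.norm_eq_abs] at h1
  have h3 := norm_le_norm_add_norm_sub' (gradFlow f x t) x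
  linarith

namespace IsSemiflow

variable {g : E → E} {φ : E → ℝ → E}

theorem deriv_Icc (h : IsSemiflow g φ) (x : E) (T : ℝ) :
    ∀ t ∈ Set.Icc 0 T, HasDerivWithinAt (φ x) (g (φ x t)) (Set.Icc 0 T) t := fun t ht =>
  (h.deriv x t ht.1).mono Set.Icc_subset_Ici_self

theorem deriv_shift (h : IsSemiflow g φ) (x : E) (s : ℝ) {t : ℝ} (ht : s ≤ t) :
    HasDerivWithinAt (fun τ => φ x (τ - s)) (g (φ x (t - s))) (Set.Ici s) t := by
  have h1 := (h.deriv x (t - s) (sub_nonneg.2 ht)).scomp t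
    (((hasDerivAt_id t).sub_const s).hasDerivWithinAt (s := Set.Ici s))
    (fun τ hτ => by simpa using hτ)
  simpa [Function.comp_def] using h1

theorem comp_add [FiniteDimensional ℝ E] (h : IsSemiflow g φ) (hg : ContDiff ℝ 1 g) (x : E)
    {s t : ℝ} (hs : 0 ≤ s) (ht : 0 ≤ t) : φ (φ x s) t = φ x (s + t) := by
  refine eqOn_of_solutions hg (γ := φ (φ x s)) (δ := fun τ => φ x (s + τ)) (T := t)
    (h.deriv_Icc _ t) (fun τ hτ => ?_) (by simp [h.zero]) ⟨ht, le_rfl⟩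
  have h1 := (h.deriv x (s + τ) (add_nonneg hs hτ.1)).scomp τ
    (((hasDerivAt_id τ).const_add s).hasDerivWithinAt (s := Set.Icc 0 t))
    (fun r hr => add_nonneg hs hr.1)
  simpa [Function.comp_def] using h1

/-- Grönwall's inequality: trajectories from a unit ball around `x` stay in one bounded set up to
time `t`, where `g` is Lipschitz. -/
theorem continuous [FiniteDimensional ℝ E] (h : IsSemiflow g φ) (hg : ContDiff ℝ 1 g) {t : ℝ}
    (ht : 0 ≤ t) : Continuous fun x => φ x t := by
  rw [continuous_iff_continuousAt]
  intro x
  obtain ⟨R, hR⟩ := h.bounded (‖x‖ + 1) t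
  obtain ⟨K, hK⟩ := exists_lipschitzOnWith_closedBall hg R
  have hc : ∀ y, ContinuousOn (φ y) (Set.Icc 0 t) := fun y τ hτ =>
    (h.deriv_Icc y t τ hτ).continuousWithinAt
  have hd : ∀ y, ∀ τ ∈ Set.Ico 0 t, HasDerivWithinAt (φ y) (g (φ y τ)) (Set.Ici τ) τ :=
    fun y τ hτ => (h.deriv y τ hτ.1).mono (Set.Ici_subset_Ici.2 hτ.1)
  have hest : ∀ y ∈ Metric.ball x 1, dist (φ y t) (φ x t) ≤ dist y x * Real.exp (K * (t - 0)) := by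
    intro y hy
    have hy' : ‖y‖ ≤ ‖x‖ + 1 := by
      have := norm_le_norm_add_norm_sub' y x
      have := mem_ball_iff_norm.1 hy
      linarith
    refine dist_le_of_trajectories_ODE_of_mem (v := fun _ => g) (δ := dist y x)
      (s := fun _ => Metric.closedBall 0 R) (fun _ _ => hK) (hc y) (hd y) ?_ (hc x) (hd x) ?_ ?_ t
      ⟨ht, le_rfl⟩
    · exact fun τ hτ => by simpa using hR y hy' τ ⟨hτ.1, hτ.2.le⟩
    · exact fun τ hτ => by simpa using hR x (by linarith) τ ⟨hτ.1, hτ.2.le⟩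
    · rw [h.zero, h.zero]
  rw [ContinuousAt, tendsto_iff_dist_tendsto_zero]
  refine squeeze_zero' (Eventually.of_forall fun _ => dist_nonneg)
    (eventually_of_mem (Metric.ball_mem_nhds x one_pos) hest) ?_
  have : Continuous fun y => dist y x * Real.exp (K * (t - 0)) := by fun_prop
  simpa using this.tendsto x

/-- The component of a trajectory transverse to an invariant affine subspace `c + V` satisfies a
linear differential inequality; hence `c + V` is invariant forwards and backwards in time. -/
theorem sub_mem_iff [FiniteDimensional ℝ E] (h : IsSemiflow g φ) (hg : ContDiff ℝ 1 g)
    {V : Submodule ℝ E} {c : E} (hV : ∀ v ∈ V, g (c + v) ∈ V) (x : E) {t : ℝ} (ht : 0 ≤ t) :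
    φ x t - c ∈ V ↔ x - c ∈ V := by
  obtain ⟨R, hR⟩ := h.bounded ‖x‖ t
  obtain ⟨K, hK⟩ := exists_lipschitzOnWith_closedBall hg (‖c‖ + (R + ‖c‖))
  set Q := Vᗮ.starProjection with hQ
  have hQ0 : ∀ y, Q y = 0 ↔ y ∈ V := fun y => by
    rw [hQ, Submodule.starProjection_apply_eq_zero_iff, Submodule.orthogonal_orthogonal]
  have hQ1 : ∀ y, ‖Q y‖ ≤ ‖y‖ := fun y => Vᗮ.norm_starProjection_apply_le y
  -- Replacing `y` by its component in `V` changes it by `Q y`, and at the replaced point the field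
  -- lies in `V`, hence is killed by `Q`; the Lipschitz bound does the rest.
  have hbound : ∀ τ ∈ Set.Icc 0 t, ‖Q (g (φ x τ))‖ ≤ K * ‖Q (φ x τ - c)‖ := by
    intro τ hτ
    set y := φ x τ - c with hy
    have hyV : y - Q y ∈ V := by
      rw [← hQ0, map_sub]
      have : Q (Q y) = Q y :=
        Submodule.starProjection_eq_self_iff.2 (Vᗮ.starProjection_apply_mem y)
      rw [this, sub_self]
    have hyn : ‖y‖ ≤ R + ‖c‖ := (norm_sub_le _ _).trans (by gcongr; exact hR x le_rfl τ hτ)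
    have hyn' : ‖y - Q y‖ ≤ R + ‖c‖ := by
      have : y - Q y = V.starProjection y := by
        rw [hQ, Submodule.starProjection_orthogonal]; simp
      rw [this]
      exact (V.norm_starProjection_apply_le y).trans hyn
    have e1 : φ x τ = c + y := by rw [hy]; abel
    have e2 : Q (g (φ x τ)) = Q (g (c + y) - g (c + (y - Q y))) := by
      rw [map_sub, (hQ0 _).2 (hV _ hyV), sub_zero, e1]
    rw [e2]
    refine (hQ1 _).trans ?_
    have := hK.norm_sub_le (x := c + y) (y := c + (y - Q y))
      (by simpa using (norm_add_le _ _).trans (by gcongr))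
      (by simpa using (norm_add_le _ _).trans (by gcongr))
    simpa using this
  have hd : ∀ τ ∈ Set.Icc 0 t,
      HasDerivWithinAt (fun s => Q (φ x s - c)) (Q (g (φ x τ))) (Set.Icc 0 t) τ := fun τ hτ =>
    Q.hasFDerivAt.comp_hasDerivWithinAt τ ((h.deriv_Icc x t τ hτ).sub_const c)
  have hc : ContinuousOn (fun s => Q (φ x s - c)) (Set.Icc 0 t) := fun τ hτ =>
    (hd τ hτ).continuousWithinAt
  constructor
  · intro hmem
    -- Time reversal turns vanishing at the final time into vanishing at the initial time; the
    -- differential inequality is insensitive to the sign of the derivative.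
    have hrev : Set.MapsTo (fun s => t - s) (Set.Icc 0 t) (Set.Icc 0 t) := fun s hs =>
      ⟨sub_nonneg.2 hs.2, by linarith [hs.1]⟩
    have := eq_zero_of_abs_deriv_le_mul_abs_self_of_eq_zero_right (a := 0) (b := t) (K := K)
      (f := fun s => Q (φ x (t - s) - c)) (f' := fun s => -Q (g (φ x (t - s))))
      (hc.comp (by fun_prop) hrev)
      (fun s hs => by
        have h1 := (hd (t - s) (hrev ⟨hs.1, hs.2.le⟩)).scomp s
          (((hasDerivAt_id s).const_sub t).hasDerivWithinAt (s := Set.Icc 0 t)) hrev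
        have h2 : HasDerivWithinAt (fun s => Q (φ x (t - s) - c)) (-Q (g (φ x (t - s))))
          (Set.Icc 0 t) s := by simpa [Function.comp_def] using h1
        exact h2.mono_of_mem_nhdsWithin (Icc_mem_nhdsGE_of_mem hs))
      (by simpa using (hQ0 _).2 hmem)
      (fun s hs => by
        rw [norm_neg]
        exact hbound (t - s) (hrev ⟨hs.1, hs.2.le⟩)) t ⟨ht, le_rfl⟩
    rw [← hQ0, ← h.zero x]
    simpa only [sub_self] using this
  · intro hmem
    refine (hQ0 _).1 (eq_zero_of_abs_deriv_le_mul_abs_self_of_eq_zero_right (a := 0) (b := t)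
      (K := K) hc (fun s hs => (hd s ⟨hs.1, hs.2.le⟩).mono_of_mem_nhdsWithin
        (Icc_mem_nhdsGE_of_mem hs)) ?_ (fun s hs => hbound s ⟨hs.1, hs.2.le⟩) t ⟨ht, le_rfl⟩)
    rw [h.zero]
    exact (hQ0 _).2 hmem

end IsSemiflow

end Semiflow

/-! ### The spectral gap below the top eigenvalue. -/

section Spectral

variable {E : Type*} [NormedAddCommGroup E] [InnerProductSpace ℝ E]

/-- The symmetric operator `L` acts as `lam` on `W`, and its quadratic form is at most `lam - μ`
on the orthogonal complement of `W`. -/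
structure IsTopSpectralSplit (L : E →L[ℝ] E) (W : Submodule ℝ E) (lam μ : ℝ) : Prop where
  lam_pos : 0 < lam
  gap_pos : 0 < μ
  symm : ∀ x y, inner ℝ (L x) y = inner ℝ x (L y)
  eigen : ∀ x ∈ W, L x = lam • x
  gap : ∀ x ∈ Wᗮ, inner ℝ x (L x) ≤ (lam - μ) * ‖x‖ ^ 2

namespace IsTopSpectralSplit

variable {L : E →L[ℝ] E} {W : Submodule ℝ E} {lam μ : ℝ}

theorem map_orthogonal (h : IsTopSpectralSplit L W lam μ) {x : E} (hx : x ∈ Wᗮ) : L x ∈ Wᗮ := by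
  rw [Submodule.mem_orthogonal] at hx ⊢
  intro u hu
  rw [← h.symm, h.eigen u hu, inner_smul_left, hx u hu, mul_zero]

variable [FiniteDimensional ℝ E]

theorem starProjection_map (h : IsTopSpectralSplit L W lam μ) (x : E) :
    W.starProjection (L x) = lam • W.starProjection x := by
  have hx : x = W.starProjection x + Wᗮ.starProjection x :=
    (W.starProjection_add_starProjection_orthogonal x).symm
  conv_lhs => rw [hx, map_add, map_add, h.eigen _ (W.starProjection_apply_mem x), map_smul]
  rw [Submodule.starProjection_eq_self_iff.2 (W.starProjection_apply_mem x),
    (Submodule.starProjection_apply_eq_zero_iff W).2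
      (h.map_orthogonal (Wᗮ.starProjection_apply_mem x)), add_zero]

theorem orthogonal_starProjection_map (h : IsTopSpectralSplit L W lam μ) (x : E) :
    Wᗮ.starProjection (L x) = L (Wᗮ.starProjection x) := by
  have h1 := W.starProjection_add_starProjection_orthogonal x
  have h2 := W.starProjection_add_starProjection_orthogonal (L x)
  rw [h.starProjection_map, ← h.eigen _ (W.starProjection_apply_mem x)] at h2
  rw [eq_sub_of_add_eq' h2, eq_sub_of_add_eq' h1, map_sub]

theorem inner_map_le (h : IsTopSpectralSplit L W lam μ) (x : E) :
    inner ℝ x (L x) ≤ lam * ‖x‖ ^ 2 := by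
  set p := W.starProjection x with hp
  set q := Wᗮ.starProjection x with hq
  have hx : x = p + q := (W.starProjection_add_starProjection_orthogonal x).symm
  have hpW : p ∈ W := W.starProjection_apply_mem x
  have hqW : q ∈ Wᗮ := Wᗮ.starProjection_apply_mem x
  have h0 : inner ℝ p q = 0 := Submodule.inner_right_of_mem_orthogonal hpW hqW
  have h1 : inner ℝ p (L q) = 0 :=
    Submodule.inner_right_of_mem_orthogonal hpW (h.map_orthogonal hqW)
  have h2 : inner ℝ q p = 0 := by rw [real_inner_comm]; exact h0
  have hn : ‖x‖ ^ 2 = ‖p‖ ^ 2 + ‖q‖ ^ 2 := by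
    rw [hx, norm_add_sq_real, h0]; ring
  rw [hn, hx, map_add, h.eigen p hpW, inner_add_left, inner_add_right, inner_add_right, h1,
    inner_smul_right, inner_smul_right, h2, real_inner_self_eq_norm_sq]
  nlinarith [h.gap q hqW, h.gap_pos, sq_nonneg ‖q‖]

end IsTopSpectralSplit

/-- A top eigenvalue of a symmetric operator is separated from the rest of the spectrum. -/
theorem exists_isTopSpectralSplit [FiniteDimensional ℝ E] {L : E →L[ℝ] E}
    (hL : (L : E →ₗ[ℝ] E).IsSymmetric) {lam : ℝ} (hpos : 0 < lam) (htop : IsTopEigenvalue L lam) :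
    ∃ μ, IsTopSpectralSplit L (Module.End.eigenspace (L : E →ₗ[ℝ] E) lam) lam μ := by
  set W := Module.End.eigenspace (L : E →ₗ[ℝ] E) lam with hW
  have heig : ∀ x ∈ W, L x = lam • x := fun x hx => Module.End.mem_eigenspace_iff.1 hx
  have hinv : ∀ x ∈ Wᗮ, (L : E →ₗ[ℝ] E) x ∈ Wᗮ := by
    intro x hx
    rw [Submodule.mem_orthogonal] at hx ⊢
    intro u hu
    rw [← hL, ContinuousLinearMap.coe_coe, heig u hu, inner_smul_left, hx u hu, mul_zero]
  suffices h : ∃ μ > 0, ∀ x ∈ Wᗮ, inner ℝ x (L x) ≤ (lam - μ) * ‖x‖ ^ 2 by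
    obtain ⟨μ, hμ, h⟩ := h
    exact ⟨μ, hpos, hμ, hL, heig, h⟩
  rcases subsingleton_or_nontrivial Wᗮ with hs | hn
  · refine ⟨1, one_pos, fun x hx => ?_⟩
    have : x = 0 := by simpa using congrArg Subtype.val (Subsingleton.elim (⟨x, hx⟩ : Wᗮ) 0)
    simp [this]
  set T : Wᗮ →ₗ[ℝ] Wᗮ := (L : E →ₗ[ℝ] E).restrict hinv with hT
  have hTs : T.IsSymmetric := hL.restrict_invariant hinv
  -- The supremum ν of the Rayleigh quotient on `Wᗮ` is itself an eigenvalue. It is at most `lam`,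
  -- and not equal to it because its eigenvector is orthogonal to `W`; so the gap is `lam - ν`.
  have hν := hTs.hasEigenvalue_iSup_of_finiteDimensional
  set ν : ℝ := ⨆ x : { x : Wᗮ // x ≠ 0 }, RCLike.re (inner ℝ (T x) x) / ‖(x : Wᗮ)‖ ^ 2 with hν_def
  obtain ⟨y, hy⟩ := hν.exists_hasEigenvector
  have hy1 : L y = ν • (y : E) := by
    exact congrArg Subtype.val hy.apply_eq_smul
  have hy0 : (y : E) ≠ 0 := fun h => hy.2 (Subtype.ext h)
  have hνle : ν ≤ lam := htop.2 (Module.End.hasEigenvalue_of_hasEigenvector (x := (y : E))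
    ⟨Module.End.mem_eigenspace_iff.2 hy1, hy0⟩)
  have hνne : ν ≠ lam := by
    intro h
    have hyW : (y : E) ∈ W := Module.End.mem_eigenspace_iff.2 (h ▸ hy1)
    exact hy0 (inner_self_eq_zero.1 (Submodule.inner_right_of_mem_orthogonal hyW y.2))
  have hbdd : BddAbove (Set.range fun x : { x : Wᗮ // x ≠ 0 } =>
      RCLike.re (inner ℝ (T x) (x : Wᗮ)) / ‖(x : Wᗮ)‖ ^ 2) := by
    refine ⟨‖L‖, ?_⟩
    rintro _ ⟨x, rfl⟩
    have hx : 0 < ‖(x : Wᗮ)‖ := norm_pos_iff.2 x.2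
    rw [div_le_iff₀ (by positivity)]
    have h1 : inner ℝ (T x) (x : Wᗮ) = inner ℝ (L (x : Wᗮ)) ((x : Wᗮ) : E) := rfl
    rw [h1]
    refine (real_inner_le_norm _ _).trans ?_
    have := L.le_opNorm ((x : Wᗮ) : E)
    have h2 : ‖((x : Wᗮ) : E)‖ = ‖(x : Wᗮ)‖ := rfl
    rw [h2] at this ⊢
    nlinarith
  refine ⟨lam - ν, sub_pos.2 (lt_of_le_of_ne hνle hνne), fun x hx => ?_⟩
  rw [sub_sub_cancel]
  by_cases hx0 : x = 0
  · simp [hx0]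
  have h1 := le_ciSup hbdd ⟨⟨x, hx⟩, fun h => hx0 (congrArg Subtype.val h)⟩
  rw [← hν_def] at h1
  have hxp : 0 < ‖x‖ := norm_pos_iff.2 hx0
  have h2 : inner ℝ (L x) x / ‖x‖ ^ 2 ≤ ν := h1
  rwa [div_le_iff₀ (by positivity), real_inner_comm] at h2

end Spectral

/-! ### Estimates near the critical point, uniform in the release time. -/

section Escape

variable {E : Type*} [NormedAddCommGroup E] [InnerProductSpace ℝ E]

/-- The derivative of the remainder at `z` is `fderiv ℝ g (c + z) - fderiv ℝ g c`, of size `O(‖z‖)`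
since `fderiv ℝ g` is locally Lipschitz; then apply the mean value inequality. -/
theorem exists_quadratic_remainder [FiniteDimensional ℝ E] {g : E → E} (hg : ContDiff ℝ 2 g)
    (c : E) : ∃ C > 0, ∀ r ≤ (1 : ℝ), ∀ x y, ‖x‖ ≤ r → ‖y‖ ≤ r →
      ‖(g (c + x) - fderiv ℝ g c x) - (g (c + y) - fderiv ℝ g c y)‖ ≤ C * r * ‖x - y‖ := by
  obtain ⟨K, hK⟩ := exists_lipschitzOnWith_closedBall
    (hg.fderiv_right (m := 1) (by rw [one_add_one_eq_two])) (‖c‖ + 1)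
  refine ⟨K + 1, by positivity, fun r hr x y hx hy => ?_⟩
  have hd : ∀ z ∈ Metric.closedBall (0 : E) r, HasFDerivWithinAt
      (fun z => g (c + z) - fderiv ℝ g c z) (fderiv ℝ g (c + z) - fderiv ℝ g c)
      (Metric.closedBall 0 r) z := by
    intro z _
    have h1 : HasFDerivAt g (fderiv ℝ g (c + z)) (c + z) :=
      ((hg.differentiable two_ne_zero) (c + z)).hasFDerivAt
    exact (((h1.comp z ((hasFDerivAt_id z).const_add c))).sub
      (fderiv ℝ g c).hasFDerivAt).hasFDerivWithinAt
  have := (convex_closedBall (0 : E) r).norm_image_sub_le_of_norm_hasFDerivWithin_le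
    (C := (K + 1) * r) hd (fun z hz => by
      rw [mem_closedBall_zero_iff] at hz
      have h1 := hK.norm_sub_le (x := c + z) (y := c)
        (by simpa using (norm_add_le _ _).trans (by gcongr; linarith)) (by simp)
      rw [add_sub_cancel_left] at h1
      refine h1.trans ?_
      have : (0 : ℝ) ≤ K := K.2
      nlinarith [norm_nonneg z]) (by simpa using hy) (by simpa using hx)
  exact this

/-- The data of a trajectory, relative to a critical point `c`, that starts at time `a` near `c`. -/
structure IsEscapingCurve (g : E → E) (c : E) (lam R a : ℝ) (x : ℝ → E) : Prop where
  deriv : ∀ t, a ≤ t → HasDerivWithinAt x (g (c + x t)) (Set.Ici a) t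
  norm_start_le : ‖x a‖ ≤ R * Real.exp (lam * a)

/-- The constants that control a trajectory up to time `b`. -/
structure IsEscapeScale (g : E → E) (c : E) (lam C R b : ℝ) : Prop where
  C_pos : 0 < C
  R_pos : 0 < R
  remainder : ∀ r ≤ (1 : ℝ), ∀ x y, ‖x‖ ≤ r → ‖y‖ ≤ r →
      ‖(g (c + x) - fderiv ℝ g c x) - (g (c + y) - fderiv ℝ g c y)‖ ≤ C * r * ‖x - y‖
  crit : g c = 0
  barrier : (4 * C * R + 1) / lam * Real.exp (lam * b) ≤ 1
  small : 2 * R * Real.exp (lam * b) ≤ 1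
  rate : C * (2 * R * Real.exp (lam * b)) ≤ lam / 4

variable {g : E → E} {c : E} {W : Submodule ℝ E} {lam μ C R a b : ℝ}

/-- `C` does not depend on `b`, so every smallness condition holds once `b` is negative enough. The
release time does not enter, which is what later permits it to tend to `-∞`. -/
theorem exists_isEscapeScale [FiniteDimensional ℝ E] (hg : ContDiff ℝ 2 g) (hc : g c = 0)
    (hlam : 0 < lam) (hR : 0 < R) :
    ∃ C b, IsEscapeScale g c lam C R b := by
  obtain ⟨C, hC, h⟩ := exists_quadratic_remainder hg c
  have hexp : Tendsto (fun b => Real.exp (lam * b)) atBot (𝓝 0) :=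
    Real.tendsto_exp_atBot.comp (tendsto_id.const_mul_atBot hlam)
  have h1 : ∀ k δ : ℝ, 0 < δ → ∀ᶠ b in atBot, k * Real.exp (lam * b) ≤ δ := fun k δ hδ => by
    have := hexp.const_mul k
    rw [mul_zero] at this
    exact this.eventually (ge_mem_nhds hδ)
  obtain ⟨b, h2, h3, h4⟩ := ((h1 ((4 * C * R + 1) / lam) 1 one_pos).and
    ((h1 (2 * R) 1 one_pos).and (h1 (C * (2 * R)) (lam / 4) (by positivity)))).exists
  exact ⟨C, b, hC, hR, h, hc, h2, h3, by linarith⟩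

namespace IsEscapeScale

theorem norm_remainder_le (hs : IsEscapeScale g c lam C R b) {x : E} {r : ℝ} (hr : r ≤ 1)
    (hx : ‖x‖ ≤ r) : ‖g (c + x) - fderiv ℝ g c x‖ ≤ C * r ^ 2 := by
  have h0 : 0 ≤ r := (norm_nonneg x).trans hx
  have h := hs.remainder r hr x 0 hx (by simpa using h0)
  simp only [add_zero, map_zero, sub_zero, hs.crit] at h
  refine h.trans ?_
  have := hs.C_pos
  rw [pow_two, ← mul_assoc]
  gcongr

variable [FiniteDimensional ℝ E]

/-- The barrier is `m = R e^{λt}(1 + D e^{λt})`. Compared with pure growth at rate λ it has the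
surplus derivative `R D λ e^{2λt}`, and `D λ = 4 C R + 1` makes this exceed the remainder `C m² ≤ 4
C R² e^{2λt}`. -/
theorem norm_le (hs : IsEscapeScale g c lam C R b)
    (hW : IsTopSpectralSplit (fderiv ℝ g c) W lam μ) {x : ℝ → E}
    (hx : IsEscapingCurve g c lam R a x) :
    ∀ t ∈ Set.Icc a b, ‖x t‖ ≤ 2 * R * Real.exp (lam * t) := by
  have hlam := hW.lam_pos
  have hC := hs.C_pos
  have hR := hs.R_pos
  set D := (4 * C * R + 1) / lam with hD
  have hD0 : 0 < D := by positivity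
  have hDlam : D * lam = 4 * C * R + 1 := by rw [hD]; field_simp
  have hDt : ∀ t ∈ Set.Icc a b, D * Real.exp (lam * t) ≤ 1 := fun t ht => by
    refine le_trans ?_ hs.barrier
    gcongr
    exact ht.2
  have hle : ∀ t ∈ Set.Icc a b,
      R * Real.exp (lam * t) * (1 + D * Real.exp (lam * t)) ≤ 2 * R * Real.exp (lam * t) := by
    intro t ht
    have h1 := hDt t ht
    have h2 : 0 < R * Real.exp (lam * t) := by positivity
    nlinarith
  have h2R : ∀ t ∈ Set.Icc a b, 2 * R * Real.exp (lam * t) ≤ 1 := fun t ht => by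
    refine le_trans ?_ hs.small
    gcongr
    exact ht.2
  intro t ht
  refine le_trans ?_ (hle t ht)
  refine norm_le_of_inner_lt_barrier (x' := fun t => g (c + x t))
    (m := fun t => R * Real.exp (lam * t) * (1 + D * Real.exp (lam * t)))
    (m' := fun t => lam * (R * Real.exp (lam * t) * (1 + D * Real.exp (lam * t))) +
      R * (D * lam) * Real.exp (lam * t) ^ 2)
    (fun t ht => hx.deriv t ht.1) ?_ (fun t => by positivity) ?_ ?_ t ht
  · intro t
    have h1 : HasDerivAt (fun t => Real.exp (lam * t)) (Real.exp (lam * t) * lam) t := by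
      simpa using ((hasDerivAt_id t).const_mul lam).exp
    exact ((h1.const_mul R).mul ((h1.const_mul D).const_add 1)).congr_deriv (by ring)
  · refine hx.norm_start_le.trans (le_mul_of_one_le_right (by positivity) ?_)
    have : 0 < D * Real.exp (lam * a) := by positivity
    linarith
  · intro t ht hxt
    set m := R * Real.exp (lam * t) * (1 + D * Real.exp (lam * t)) with hm
    have hm0 : 0 < m := by positivity
    have hq := hs.norm_remainder_le ((hle t ht).trans (h2R t ht)) hxt.le
    have h1 : inner ℝ (x t) (g (c + x t)) =
        inner ℝ (x t) (fderiv ℝ g c (x t)) + inner ℝ (x t) (g (c + x t) - fderiv ℝ g c (x t)) := by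
      rw [← inner_add_right, add_sub_cancel]
    have h2 := hW.inner_map_le (x t)
    have h3 := (real_inner_le_norm (x t) (g (c + x t) - fderiv ℝ g c (x t)))
    rw [hxt] at h2 h3
    have h4 : m * ‖g (c + x t) - fderiv ℝ g c (x t)‖ ≤ m * (C * m ^ 2) := by gcongr
    have h5 : m ^ 2 ≤ (2 * R * Real.exp (lam * t)) ^ 2 := by gcongr; exact hle t ht
    have h6 : C * m ^ 2 < R * (D * lam) * Real.exp (lam * t) ^ 2 := by
      rw [hDlam]
      have : C * m ^ 2 ≤ C * (2 * R * Real.exp (lam * t)) ^ 2 := by gcongr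
      have h7 : 0 < R * Real.exp (lam * t) ^ 2 := by positivity
      nlinarith
    have h7 := mul_lt_mul_of_pos_left h6 hm0
    rw [h1]
    nlinarith

/-- The component along the top eigenspace is, after rescaling, nearly constant. -/
theorem norm_starProjection_sub_le (hs : IsEscapeScale g c lam C R b)
    (hW : IsTopSpectralSplit (fderiv ℝ g c) W lam μ) {x : ℝ → E}
    (hx : IsEscapingCurve g c lam R a x) :
    ∀ t ∈ Set.Icc a b, ‖Real.exp (-(lam * t)) • W.starProjection (x t) -
      Real.exp (-(lam * a)) • W.starProjection (x a)‖ ≤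
        4 * C * R ^ 2 / lam * Real.exp (lam * t) := by
  have hlam := hW.lam_pos
  have hC := hs.C_pos
  have hR := hs.R_pos
  have hd : ∀ t, a ≤ t → HasDerivWithinAt
      (fun t => Real.exp (-(lam * t)) • W.starProjection (x t))
      (Real.exp (-(lam * t)) • W.starProjection (g (c + x t) - fderiv ℝ g c (x t)))
      (Set.Ici a) t := by
    intro t ht
    have h1 : HasDerivWithinAt (fun t => Real.exp (-(lam * t))) (Real.exp (-(lam * t)) * -lam)
        (Set.Ici a) t := by
      simpa using (((hasDerivAt_id t).const_mul lam).neg).exp.hasDerivWithinAt (s := Set.Ici a)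
    have h2 : HasDerivWithinAt (fun t => W.starProjection (x t)) (W.starProjection (g (c + x t)))
        (Set.Ici a) t := W.starProjection.hasFDerivAt.comp_hasDerivWithinAt t (hx.deriv t ht)
    refine (h1.smul h2).congr_deriv ?_
    rw [map_sub, hW.starProjection_map]
    module
  refine image_norm_le_of_norm_deriv_right_le_deriv_boundary
    (f := fun t => Real.exp (-(lam * t)) • W.starProjection (x t) -
      Real.exp (-(lam * a)) • W.starProjection (x a))
    (f' := fun t => Real.exp (-(lam * t)) • W.starProjection (g (c + x t) - fderiv ℝ g c (x t)))
    (B := fun t => 4 * C * R ^ 2 / lam * Real.exp (lam * t))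
    (B' := fun t => 4 * C * R ^ 2 * Real.exp (lam * t))
    (fun t ht => ((hd t ht.1).continuousWithinAt.mono Set.Icc_subset_Ici_self).sub
      continuousWithinAt_const)
    (fun t ht => ((hd t ht.1).mono (Set.Ici_subset_Ici.2 ht.1)).sub_const _)
    ?_ ?_ ?_
  · simp only [sub_self, norm_zero]; positivity
  · intro t
    have h1 : HasDerivAt (fun t => Real.exp (lam * t)) (Real.exp (lam * t) * lam) t := by
      simpa using ((hasDerivAt_id t).const_mul lam).exp
    exact (h1.const_mul _).congr_deriv (by field_simp)
  · intro t ht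
    have ht' : t ∈ Set.Icc a b := ⟨ht.1, ht.2.le⟩
    have hr : 2 * R * Real.exp (lam * t) ≤ 1 := by
      refine le_trans ?_ hs.small
      gcongr
      exact ht.2.le
    have hq := hs.norm_remainder_le hr (hs.norm_le hW hx t ht')
    have hp := (W.norm_starProjection_apply_le (g (c + x t) - fderiv ℝ g c (x t))).trans hq
    rw [norm_smul, Real.norm_of_nonneg (Real.exp_pos _).le]
    calc _ ≤ Real.exp (-(lam * t)) * (C * (2 * R * Real.exp (lam * t)) ^ 2) := by gcongr
      _ = (Real.exp (-(lam * t)) * Real.exp (lam * t)) * (4 * C * R ^ 2 * Real.exp (lam * t)) := by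
        ring
      _ = _ := by rw [← Real.exp_add]; simp

/-- The component orthogonal to the top eigenspace is of lower order. -/
theorem norm_orthogonal_starProjection_le (hs : IsEscapeScale g c lam C R b)
    (hW : IsTopSpectralSplit (fderiv ℝ g c) W lam μ) {x : ℝ → E}
    (hx : IsEscapingCurve g c lam R a x) :
    ∀ t ∈ Set.Icc a b, ‖Wᗮ.starProjection (x t)‖ ≤ Real.exp (lam * t) *
      (R * Real.exp (-(μ * (t - a))) + (4 * C * R ^ 2 + 1) / lam * Real.exp (lam * t)) := by
  have hlam := hW.lam_pos
  have hμ := hW.gap_pos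
  have hC := hs.C_pos
  have hR := hs.R_pos
  set D := (4 * C * R ^ 2 + 1) / lam with hD
  have hD0 : 0 < D := by positivity
  have hDlam : D * lam = 4 * C * R ^ 2 + 1 := by rw [hD]; field_simp
  -- The first summand of the barrier grows at the transverse rate `lam - μ`; the second absorbs the
  -- quadratic forcing `4 C R² e^{2λt}`.
  refine norm_le_of_inner_lt_barrier (x' := fun t => Wᗮ.starProjection (g (c + x t)))
    (m' := fun t => (lam - μ) * (Real.exp (lam * t) * (R * Real.exp (-(μ * (t - a))) +
      D * Real.exp (lam * t))) + (D * lam + μ * D) * Real.exp (lam * t) ^ 2)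
    (fun t ht => Wᗮ.starProjection.hasFDerivAt.comp_hasDerivWithinAt t (hx.deriv t ht.1))
    ?_ (fun t => by positivity) ?_ ?_
  · intro t
    have h1 : HasDerivAt (fun t => Real.exp (lam * t)) (Real.exp (lam * t) * lam) t := by
      simpa using ((hasDerivAt_id t).const_mul lam).exp
    have h2 : HasDerivAt (fun t => Real.exp (-(μ * (t - a)))) (Real.exp (-(μ * (t - a))) * -μ) t := by
      simpa using ((((hasDerivAt_id t).sub_const a).const_mul μ).neg).exp
    exact (h1.mul ((h2.const_mul R).add (h1.const_mul D))).congr_deriv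
      (by simp only [Pi.add_apply]; ring)
  · refine ((Wᗮ.norm_starProjection_apply_le _).trans hx.norm_start_le).trans ?_
    simp only [sub_self, mul_zero, neg_zero, Real.exp_zero, mul_one]
    have : 0 < Real.exp (lam * a) * (D * Real.exp (lam * a)) := by positivity
    linarith
  · intro t ht hxt
    set m := Real.exp (lam * t) * (R * Real.exp (-(μ * (t - a))) + D * Real.exp (lam * t)) with hm
    have hm0 : 0 < m := by positivity
    have hr : 2 * R * Real.exp (lam * t) ≤ 1 := by
      refine le_trans ?_ hs.small
      gcongr
      exact ht.2
    have hq := hs.norm_remainder_le hr (hs.norm_le hW hx t ht)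
    set q := g (c + x t) - fderiv ℝ g c (x t) with hq_def
    set n := Wᗮ.starProjection (x t) with hn
    have h1 : Wᗮ.starProjection (g (c + x t)) = fderiv ℝ g c n + Wᗮ.starProjection q := by
      rw [hq_def, map_sub, hW.orthogonal_starProjection_map, add_sub_cancel]
    have h2 := hW.gap n (Wᗮ.starProjection_apply_mem _)
    have h3 := real_inner_le_norm n (Wᗮ.starProjection q)
    have h4 := (Wᗮ.norm_starProjection_apply_le q).trans hq
    rw [hxt] at h2 h3
    have h5 : m * ‖Wᗮ.starProjection q‖ ≤ m * (C * (2 * R * Real.exp (lam * t)) ^ 2) := by gcongr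
    have h6 : C * (2 * R * Real.exp (lam * t)) ^ 2 < (D * lam + μ * D) * Real.exp (lam * t) ^ 2 := by
      rw [hDlam]
      have h7 : 0 < (1 + μ * D) * Real.exp (lam * t) ^ 2 := by positivity
      nlinarith
    have h7 := mul_lt_mul_of_pos_left h6 hm0
    rw [h1, inner_add_right]
    nlinarith

/-- Two escaping trajectories separate at a rate of at most `3 * lam / 2`. -/
theorem norm_sub_le (hs : IsEscapeScale g c lam C R b)
    (hW : IsTopSpectralSplit (fderiv ℝ g c) W lam μ) {a' : ℝ} {x y : ℝ → E}
    (hx : IsEscapingCurve g c lam R a x) (hy : IsEscapingCurve g c lam R a' y) {s δ : ℝ}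
    (has : a ≤ s) (has' : a' ≤ s) (hδ : 0 < δ) (hxy : ‖x s - y s‖ ≤ δ) :
    ∀ t ∈ Set.Icc s b, ‖x t - y t‖ ≤ δ * Real.exp (3 / 2 * lam * (t - s)) := by
  have hlam := hW.lam_pos
  have hR := hs.R_pos
  refine norm_le_of_inner_lt_barrier (x' := fun t => g (c + x t) - g (c + y t))
    (m' := fun t => δ * (Real.exp (3 / 2 * lam * (t - s)) * (3 / 2 * lam)))
    (fun t ht => ((hx.deriv t (has.trans ht.1)).mono (Set.Ici_subset_Ici.2 has)).sub
      ((hy.deriv t (has'.trans ht.1)).mono (Set.Ici_subset_Ici.2 has'))) ?_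
    (fun t => by positivity) (by simpa using hxy) ?_
  · intro t
    simpa using ((((hasDerivAt_id t).sub_const s).const_mul (3 / 2 * lam)).exp).const_mul δ
  · intro t ht hxt
    set m := δ * Real.exp (3 / 2 * lam * (t - s)) with hm
    have hm0 : 0 < m := by positivity
    have hle : 2 * R * Real.exp (lam * t) ≤ 2 * R * Real.exp (lam * b) := by
      gcongr
      exact ht.2
    have hq := hs.remainder _ hs.small (x t) (y t)
      ((hs.norm_le hW hx t ⟨has.trans ht.1, ht.2⟩).trans hle)
      ((hs.norm_le hW hy t ⟨has'.trans ht.1, ht.2⟩).trans hle)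
    set q := (g (c + x t) - fderiv ℝ g c (x t)) - (g (c + y t) - fderiv ℝ g c (y t)) with hq_def
    have h1 : g (c + x t) - g (c + y t) = fderiv ℝ g c (x t - y t) + q := by
      rw [hq_def, map_sub]; abel
    have h2 := hW.inner_map_le (x t - y t)
    have h3 := real_inner_le_norm (x t - y t) q
    rw [hxt] at h2 h3 hq
    -- The linear part contributes at most λ and the remainder at most λ/4, strictly below 3λ/2.
    have h4 : ‖q‖ ≤ lam / 4 * m := hq.trans (by gcongr; exact hs.rate)
    have h5 : m * ‖q‖ ≤ m * (lam / 4 * m) := by gcongr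
    have h6 : m * (δ * (Real.exp (3 / 2 * lam * (t - s)) * (3 / 2 * lam))) = 3 / 2 * lam * m ^ 2 := by
      rw [hm]; ring
    have h7 : 0 < lam * m ^ 2 := by positivity
    rw [h1, inner_add_right, h6]
    nlinarith

/-- To leading order an escaping trajectory is determined by its component along the top
eigenspace. -/
theorem norm_exp_smul_sub_le (hs : IsEscapeScale g c lam C R b)
    (hW : IsTopSpectralSplit (fderiv ℝ g c) W lam μ) {x : ℝ → E}
    (hx : IsEscapingCurve g c lam R a x) :
    ∀ t ∈ Set.Icc a b, ‖Real.exp (-(lam * t)) • x t -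
      Real.exp (-(lam * a)) • W.starProjection (x a)‖ ≤
        R * Real.exp (-(μ * (t - a))) + 2 * ((4 * C * R ^ 2 + 1) / lam) * Real.exp (lam * t) := by
  intro t ht
  have hlam := hW.lam_pos
  have h1 := hs.norm_starProjection_sub_le hW hx t ht
  have h2 := hs.norm_orthogonal_starProjection_le hW hx t ht
  have h3 : Real.exp (-(lam * t)) * ‖Wᗮ.starProjection (x t)‖ ≤
      R * Real.exp (-(μ * (t - a))) + (4 * C * R ^ 2 + 1) / lam * Real.exp (lam * t) := by
    refine (mul_le_mul_of_nonneg_left h2 (Real.exp_pos _).le).trans ?_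
    rw [← mul_assoc, ← Real.exp_add]
    simp
  have h4 : 4 * C * R ^ 2 / lam * Real.exp (lam * t) ≤
      (4 * C * R ^ 2 + 1) / lam * Real.exp (lam * t) := by
    gcongr
    linarith
  have h5 : Real.exp (-(lam * t)) • x t - Real.exp (-(lam * a)) • W.starProjection (x a) =
      (Real.exp (-(lam * t)) • W.starProjection (x t) -
        Real.exp (-(lam * a)) • W.starProjection (x a)) +
      Real.exp (-(lam * t)) • Wᗮ.starProjection (x t) := by
    conv_lhs => rw [← W.starProjection_add_starProjection_orthogonal (x t)]
    rw [smul_add]; abel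
  rw [h5]
  refine (norm_add_le _ _).trans ?_
  rw [norm_smul, Real.norm_of_nonneg (Real.exp_pos _).le]
  linarith

end IsEscapeScale

end Escape

/-! ### The limit trajectory on the unstable manifold. -/

section EscapeLimit

variable {E : Type*} [NormedAddCommGroup E] [InnerProductSpace ℝ E]
  {g : E → E} {φ : E → ℝ → E} {c : E} {W : Submodule ℝ E} {lam μ C R b : ℝ}

theorem IsSemiflow.isEscapingCurve (hφ : IsSemiflow g φ) {θ : E} (hθ : ‖θ‖ ≤ R) (σ : ℝ) :
    IsEscapingCurve g c lam R σ fun t => φ (c + Real.exp (lam * σ) • θ) (t - σ) - c := by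
  refine ⟨fun t ht => ?_, ?_⟩
  · simpa using (hφ.deriv_shift (c + Real.exp (lam * σ) • θ) σ ht).sub_const c
  · rw [sub_self, hφ.zero, add_sub_cancel_left, norm_smul, Real.norm_of_nonneg (Real.exp_pos _).le,
      mul_comm]
    gcongr

variable [FiniteDimensional ℝ E]

theorem IsSemiflow.norm_exp_smul_sub_le (hφ : IsSemiflow g φ) (hs : IsEscapeScale g c lam C R b)
    (hW : IsTopSpectralSplit (fderiv ℝ g c) W lam μ) {θ : E} (hθ : ‖θ‖ ≤ R) {σ t : ℝ}
    (ht : t ∈ Set.Icc σ b) :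
    ‖Real.exp (-(lam * t)) • (φ (c + Real.exp (lam * σ) • θ) (t - σ) - c) - W.starProjection θ‖ ≤
      R * Real.exp (-(μ * (t - σ))) + 2 * ((4 * C * R ^ 2 + 1) / lam) * Real.exp (lam * t) := by
  have h := hs.norm_exp_smul_sub_le hW (hφ.isEscapingCurve hθ σ) t ht
  simp only [sub_self, hφ.zero, add_sub_cancel_left, map_smul] at h
  rwa [smul_smul, ← Real.exp_add, neg_add_cancel, Real.exp_zero, one_smul] at h

/-- Trajectories released along directions with the same component in the top eigenspace merge. -/
theorem IsSemiflow.tendsto_dist_escape (hφ : IsSemiflow g φ) (hs : IsEscapeScale g c lam C R b)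
    (hW : IsTopSpectralSplit (fderiv ℝ g c) W lam μ) {θ θ' : E} (hθ : ‖θ‖ ≤ R) (hθ' : ‖θ'‖ ≤ R)
    (hP : W.starProjection θ = W.starProjection θ') {t : ℝ} (ht : t ≤ b) :
    Tendsto (fun p : ℝ × ℝ => dist (φ (c + Real.exp (lam * p.1) • θ) (t - p.1))
      (φ (c + Real.exp (lam * p.2) • θ') (t - p.2))) (atBot ×ˢ atBot) (𝓝 0) := by
  have hlam := hW.lam_pos
  have hμ := hW.gap_pos
  have hC := hs.C_pos
  have hR := hs.R_pos
  set D := (4 * C * R ^ 2 + 1) / lam with hD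
  have hD0 : 0 < D := by positivity
  rw [Metric.tendsto_nhds]
  intro ε hε
  -- A discrepancy `6 D e^{2λs}` at time `s`, amplified by `e^{3λ(t-s)/2}`, leaves a factor
  -- `e^{λs/2}`. So `s` is fixed first, and then both release times are sent to `-∞`.
  have hlim : Tendsto (fun s => 6 * D * Real.exp (3 / 2 * lam * t) * Real.exp (lam / 2 * s)) atBot
      (𝓝 0) := by
    have h := (Real.tendsto_exp_atBot.comp
      ((tendsto_id (α := ℝ)).const_mul_atBot (half_pos hlam))).const_mul
        (6 * D * Real.exp (3 / 2 * lam * t))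
    simpa using h
  obtain ⟨s, hsε, hst⟩ := ((hlim.eventually (gt_mem_nhds hε)).and (eventually_le_atBot t)).exists
  have hlim2 : Tendsto (fun σ => R * Real.exp (-(μ * (s - σ)))) atBot (𝓝 0) := by
    have h1 : Tendsto (fun σ : ℝ => -(μ * (s - σ))) atBot atBot := by
      have : (fun σ : ℝ => -(μ * (s - σ))) = fun σ => μ * σ + -(μ * s) := by funext σ; ring
      rw [this]
      exact tendsto_atBot_add_const_right _ _ (tendsto_id.const_mul_atBot hμ)
    simpa using (Real.tendsto_exp_atBot.comp h1).const_mul R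
  have hev : ∀ᶠ σ in atBot, σ ≤ s ∧ R * Real.exp (-(μ * (s - σ))) ≤ D * Real.exp (lam * s) :=
    (eventually_le_atBot s).and (hlim2.eventually (ge_mem_nhds (by positivity)))
  filter_upwards [hev.prod_mk hev] with p ⟨⟨hp1, hp1'⟩, hp2, hp2'⟩
  have h1 := hφ.norm_exp_smul_sub_le hs hW hθ (σ := p.1) (t := s) ⟨hp1, hst.trans ht⟩
  have h2 := hφ.norm_exp_smul_sub_le hs hW hθ' (σ := p.2) (t := s) ⟨hp2, hst.trans ht⟩
  set x := fun t => φ (c + Real.exp (lam * p.1) • θ) (t - p.1) - c with hx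
  set y := fun t => φ (c + Real.exp (lam * p.2) • θ') (t - p.2) - c with hy
  -- Each rescaled curve is within `3 D e^{λs}` of the common projection: `2 D e^{λs}` from the
  -- nonlinearity and `D e^{λs}` from the transverse part, by the choice of release times.
  have h3 : ‖x s - y s‖ ≤ 6 * D * Real.exp (lam * s) * Real.exp (lam * s) := by
    have h4 : ‖Real.exp (-(lam * s)) • (x s - y s)‖ ≤ 6 * D * Real.exp (lam * s) := by
      have h5 : Real.exp (-(lam * s)) • (x s - y s) =
          (Real.exp (-(lam * s)) • x s - W.starProjection θ) -
          (Real.exp (-(lam * s)) • y s - W.starProjection θ') := by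
        rw [hP, smul_sub]; abel
      rw [h5]
      refine (norm_sub_le _ _).trans ?_
      linarith
    rw [norm_smul, Real.norm_of_nonneg (Real.exp_pos _).le, Real.exp_neg, inv_mul_le_iff₀
      (Real.exp_pos _)] at h4
    linarith
  have h4 := hs.norm_sub_le hW (hφ.isEscapingCurve hθ p.1) (hφ.isEscapingCurve hθ' p.2) hp1 hp2
    (by positivity) h3 t ⟨hst, ht⟩
  have h5 : 6 * D * Real.exp (lam * s) * Real.exp (lam * s) * Real.exp (3 / 2 * lam * (t - s)) =
      6 * D * Real.exp (3 / 2 * lam * t) * Real.exp (lam / 2 * s) := by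
    rw [mul_assoc, mul_assoc, mul_assoc, mul_assoc (6 * D)]
    simp only [← Real.exp_add]
    ring_nf
  rw [h5, sub_sub_sub_cancel_right, ← dist_eq_norm] at h4
  rw [Real.dist_0_eq_abs, abs_of_nonneg dist_nonneg]
  exact h4.trans_lt hsε

/-- The limit of the trajectories released at `c + exp (lam * σ) • θ` at time `σ`, as `σ → -∞`. It
is an entire trajectory on the unstable manifold of `c`, and it is determined by the component of
`θ` in the top eigenspace of the linearization. -/
theorem IsSemiflow.exists_escape_limit (hφ : IsSemiflow g φ) (hg : ContDiff ℝ 2 g) (hc : g c = 0)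
    (hW : IsTopSpectralSplit (fderiv ℝ g c) W lam μ) (θ : E) :
    ∃ z : ℝ → E,
      (∀ t, Tendsto (fun σ => φ (c + Real.exp (lam * σ) • θ) (t - σ)) atBot (𝓝 (z t))) ∧
      (∀ t, Tendsto (fun σ => φ (c + Real.exp (lam * σ) • W.starProjection θ) (t - σ)) atBot
        (𝓝 (z t))) ∧
      (∀ s t, s ≤ t → z t = φ (z s) (t - s)) ∧
      Tendsto (fun t => Real.exp (-(lam * t)) • (z t - c)) atBot (𝓝 (W.starProjection θ)) := by
  have := FiniteDimensional.complete ℝ E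
  have hlam := hW.lam_pos
  have hμ := hW.gap_pos
  have hg1 : ContDiff ℝ 1 g := hg.of_le one_le_two
  set R := ‖θ‖ + 1 with hR_def
  have hR : 0 < R := by positivity
  obtain ⟨C, b, hs⟩ := exists_isEscapeScale hg hc hlam hR
  have hθ : ‖θ‖ ≤ R := by linarith
  have hθ' : ‖W.starProjection θ‖ ≤ R := (W.norm_starProjection_apply_le θ).trans hθ
  have hPP : W.starProjection θ = W.starProjection (W.starProjection θ) :=
    (Submodule.starProjection_eq_self_iff.2 (W.starProjection_apply_mem θ)).symm
  have hearly : ∀ t ≤ b, ∃ y,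
      Tendsto (fun σ => φ (c + Real.exp (lam * σ) • θ) (t - σ)) atBot (𝓝 y) := by
    intro t ht
    refine cauchy_map_iff_exists_tendsto.1 (cauchy_map_iff.2 ⟨inferInstance, ?_⟩)
    exact tendsto_uniformity_iff_dist_tendsto_zero.2 (hφ.tendsto_dist_escape hs hW hθ hθ rfl ht)
  -- Convergence at one time propagates to all later times by continuity of the flow map, so the
  -- local estimates are needed only up to `b`.
  have hstep : ∀ (ϑ y : E) (s t : ℝ), s ≤ t →
      Tendsto (fun σ => φ (c + Real.exp (lam * σ) • ϑ) (s - σ)) atBot (𝓝 y) →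
      Tendsto (fun σ => φ (c + Real.exp (lam * σ) • ϑ) (t - σ)) atBot (𝓝 (φ y (t - s))) := by
    intro ϑ y s t hst h
    refine (((hφ.continuous hg1 (sub_nonneg.2 hst)).tendsto y).comp h).congr' ?_
    filter_upwards [eventually_le_atBot s] with σ hσ
    rw [Function.comp_apply, hφ.comp_add hg1 _ (sub_nonneg.2 hσ) (sub_nonneg.2 hst)]
    congr 1
    ring
  have hall : ∀ t, ∃ y,
      Tendsto (fun σ => φ (c + Real.exp (lam * σ) • θ) (t - σ)) atBot (𝓝 y) := by
    intro t
    obtain ⟨y, hy⟩ := hearly (min t b) (min_le_right _ _)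
    exact ⟨_, hstep θ y _ t (min_le_left _ _) hy⟩
  choose z hz using hall
  have hz' : ∀ t ≤ b, Tendsto (fun σ => φ (c + Real.exp (lam * σ) • W.starProjection θ) (t - σ))
      atBot (𝓝 (z t)) := by
    intro t ht
    have h := (hφ.tendsto_dist_escape hs hW hθ hθ' hPP ht).comp
      (tendsto_id.prodMk (tendsto_id (x := atBot)))
    exact (tendsto_iff_of_dist h).1 (hz t)
  have hzφ : ∀ s t, s ≤ t → z t = φ (z s) (t - s) := fun s t hst =>
    tendsto_nhds_unique (hz t) (hstep θ _ s t hst (hz s))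
  refine ⟨z, hz, fun t => ?_, hzφ, ?_⟩
  · rw [hzφ (min t b) t (min_le_left _ _)]
    exact hstep _ _ _ _ (min_le_left _ _) (hz' _ (min_le_right _ _))
  · set D := 2 * ((4 * C * R ^ 2 + 1) / lam) with hD
    have hbound : ∀ t ≤ b, dist (Real.exp (-(lam * t)) • (z t - c)) (W.starProjection θ) ≤
        D * Real.exp (lam * t) := by
      intro t ht
      have hlim2 : Tendsto (fun σ => R * Real.exp (-(μ * (t - σ))) + D * Real.exp (lam * t)) atBot
          (𝓝 (D * Real.exp (lam * t))) := by
        have h1 : Tendsto (fun σ : ℝ => -(μ * (t - σ))) atBot atBot := by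
          have : (fun σ : ℝ => -(μ * (t - σ))) = fun σ => μ * σ + -(μ * t) := by funext σ; ring
          rw [this]
          exact tendsto_atBot_add_const_right _ _ (tendsto_id.const_mul_atBot hμ)
        simpa using ((Real.tendsto_exp_atBot.comp h1).const_mul R).add_const (D * Real.exp (lam * t))
      have hl : Tendsto (fun σ => ‖Real.exp (-(lam * t)) •
          (φ (c + Real.exp (lam * σ) • θ) (t - σ) - c) - W.starProjection θ‖) atBot
          (𝓝 ‖Real.exp (-(lam * t)) • (z t - c) - W.starProjection θ‖) :=
        ((((hz t).sub_const c).const_smul _).sub_const _).norm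
      rw [dist_eq_norm]
      refine le_of_tendsto_of_tendsto hl hlim2 ?_
      filter_upwards [eventually_le_atBot t] with σ hσ
      exact hφ.norm_exp_smul_sub_le hs hW hθ ⟨hσ, ht⟩
    rw [tendsto_iff_dist_tendsto_zero]
    refine squeeze_zero' (Eventually.of_forall fun _ => dist_nonneg)
      ((eventually_le_atBot b).mono hbound) ?_
    have h := (Real.tendsto_exp_atBot.comp
      ((tendsto_id (α := ℝ)).const_mul_atBot hlam)).const_mul D
    simpa using h

end EscapeLimit

/-! ### Gradient and Hessian of the risk. -/

section Parameters

variable {d : ℕ}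

/-- The parameters with factors `U` and `V`. -/
def ofFactors (U V : Matrix (Fin d) (Fin d) ℝ) : Param d :=
  WithLp.toLp 2 (Sum.elim (fun p => U p.1 p.2) fun p => V p.1 p.2)

@[simp]
theorem factorA_ofFactors (U V : Matrix (Fin d) (Fin d) ℝ) : factorA (ofFactors U V) = U := rfl

@[simp]
theorem factorB_ofFactors (U V : Matrix (Fin d) (Fin d) ℝ) : factorB (ofFactors U V) = V := rfl

@[simp]
theorem factorA_add (θ η : Param d) : factorA (θ + η) = factorA θ + factorA η := rfl

@[simp]
theorem factorB_add (θ η : Param d) : factorB (θ + η) = factorB θ + factorB η := rfl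

@[simp]
theorem factorA_smul (r : ℝ) (θ : Param d) : factorA (r • θ) = r • factorA θ := rfl

@[simp]
theorem factorB_smul (r : ℝ) (θ : Param d) : factorB (r • θ) = r • factorB θ := rfl

@[simp]
theorem factorA_neg (θ : Param d) : factorA (-θ) = -factorA θ := rfl

@[simp]
theorem factorB_neg (θ : Param d) : factorB (-θ) = -factorB θ := rfl

theorem param_ext {θ η : Param d} (hA : factorA θ = factorA η) (hB : factorB θ = factorB η) :
    θ = η := by
  ext p
  rcases p with ⟨i, j⟩ | ⟨i, j⟩
  · exact congrFun (congrFun hA i) j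
  · exact congrFun (congrFun hB i) j

/-- The Frobenius inner product of two matrices. -/
def frob (X Y : Matrix (Fin d) (Fin d) ℝ) : ℝ := ∑ i, ∑ j, X i j * Y i j

theorem frob_eq_trace (X Y : Matrix (Fin d) (Fin d) ℝ) : frob X Y = (X * Yᵀ).trace := by
  simp [frob, Matrix.trace, Matrix.mul_apply]

theorem frob_comm (X Y : Matrix (Fin d) (Fin d) ℝ) : frob X Y = frob Y X := by
  simp only [frob, mul_comm]

theorem frob_add_left (X Y Z : Matrix (Fin d) (Fin d) ℝ) :
    frob (X + Y) Z = frob X Z + frob Y Z := by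
  simp only [frob, Matrix.add_apply, add_mul, Finset.sum_add_distrib]

theorem frob_add_right (X Y Z : Matrix (Fin d) (Fin d) ℝ) :
    frob X (Y + Z) = frob X Y + frob X Z := by
  simp only [frob, Matrix.add_apply, mul_add, Finset.sum_add_distrib]

theorem frob_smul_left (r : ℝ) (X Y : Matrix (Fin d) (Fin d) ℝ) :
    frob (r • X) Y = r * frob X Y := by
  simp only [frob, Matrix.smul_apply, smul_eq_mul, mul_assoc, Finset.mul_sum]

theorem frob_smul_right (r : ℝ) (X Y : Matrix (Fin d) (Fin d) ℝ) :
    frob X (r • Y) = r * frob X Y := by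
  rw [frob_comm, frob_smul_left, frob_comm]

theorem frob_mul_transpose_left (X B U : Matrix (Fin d) (Fin d) ℝ) :
    frob (X * Bᵀ) U = frob X (U * B) := by
  rw [frob_eq_trace, frob_eq_trace, Matrix.transpose_mul, Matrix.mul_assoc]

theorem frob_transpose_mul_left (A X V : Matrix (Fin d) (Fin d) ℝ) :
    frob (Aᵀ * X) V = frob X (A * V) := by
  rw [frob_eq_trace, frob_eq_trace, Matrix.transpose_mul, Matrix.mul_assoc, Matrix.trace_mul_comm,
    Matrix.mul_assoc]

theorem inner_param (θ η : Param d) :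
    inner ℝ θ η = frob (factorA θ) (factorA η) + frob (factorB θ) (factorB η) := by
  rw [PiLp.inner_apply, Fintype.sum_sum_type, Fintype.sum_prod_type, Fintype.sum_prod_type]
  simp only [frob, factorA, factorB, Matrix.of_apply, RCLike.inner_apply, conj_trivial, mul_comm]

/-- The restriction of a matrix to the observed positions. -/
def observed (S : Finset (Fin d × Fin d)) (X : Matrix (Fin d) (Fin d) ℝ) :
    Matrix (Fin d) (Fin d) ℝ :=
  Matrix.of fun i j => if (i, j) ∈ S then X i j else 0

variable (S : Finset (Fin d × Fin d)) (M : Matrix (Fin d) (Fin d) ℝ)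

theorem frob_observed_left (X Y : Matrix (Fin d) (Fin d) ℝ) :
    frob (observed S X) Y = ∑ p ∈ S, X p.1 p.2 * Y p.1 p.2 := by
  rw [frob, ← Fintype.sum_prod_type' (f := fun i j => observed S X i j * Y i j)]
  simp [observed, ite_mul, Finset.sum_ite_mem]

theorem residualMatrix_eq_observed (θ : Param d) :
    residualMatrix S M θ = observed S (factorA θ * factorB θ - M) := rfl

theorem frob_observed_symm (X Y : Matrix (Fin d) (Fin d) ℝ) :
    frob (observed S X) Y = frob (observed S Y) X := by
  rw [frob_observed_left, frob_observed_left]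
  simp only [mul_comm]

theorem frob_observed_self_nonneg (X : Matrix (Fin d) (Fin d) ℝ) : 0 ≤ frob (observed S X) X := by
  rw [frob_observed_left]
  exact Finset.sum_nonneg fun p _ => mul_self_nonneg _

theorem observed_add (X Y : Matrix (Fin d) (Fin d) ℝ) :
    observed S (X + Y) = observed S X + observed S Y := by
  ext i j
  by_cases h : (i, j) ∈ S <;> simp [observed, h]

theorem observed_smul (r : ℝ) (X : Matrix (Fin d) (Fin d) ℝ) :
    observed S (r • X) = r • observed S X := by
  ext i j
  simp [observed]

/-- The matrix expression of the gradient of the risk. -/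
def riskGrad (θ : Param d) : Param d :=
  (2 / (S.card : ℝ)) • ofFactors (residualMatrix S M θ * (factorB θ)ᵀ)
    ((factorA θ)ᵀ * residualMatrix S M θ)

theorem contDiff_risk {n : WithTop ℕ∞} : ContDiff ℝ n (risk S M) := by
  unfold risk factorA factorB
  simp only [Matrix.mul_apply, Matrix.of_apply]
  fun_prop

theorem risk_nonneg (θ : Param d) : 0 ≤ risk S M θ := by
  unfold risk
  positivity

theorem gradient_risk (θ : Param d) : gradient (risk S M) θ = riskGrad S M θ := by
  refine ext_inner_right ℝ fun v => ?_
  have hd : DifferentiableAt ℝ (risk S M) θ :=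
    (contDiff_risk S M (n := 1)).differentiable one_ne_zero θ
  rw [inner_gradient_left]
  have h1 : HasDerivAt (fun s : ℝ => risk S M (θ + s • v)) (fderiv ℝ (risk S M) θ v) 0 := by
    have := hd.hasFDerivAt.hasLineDerivAt v
    exact this
  refine h1.unique ?_
  set E := factorA v * factorB θ + factorA θ * factorB v with hE
  set F := factorA v * factorB v with hF
  have hexp : ∀ s : ℝ, factorA (θ + s • v) * factorB (θ + s • v) =
      factorA θ * factorB θ + s • E + s ^ 2 • F := by
    intro s
    simp only [factorA_add, factorB_add, factorA_smul, factorB_smul, hE, hF, add_mul, mul_add,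
      smul_add, Matrix.smul_mul, Matrix.mul_smul, smul_smul, pow_two]
    abel
  have h2 : (fun s : ℝ => risk S M (θ + s • v)) = fun s => (1 / (S.card : ℝ)) *
      ∑ p ∈ S, ((factorA θ * factorB θ) p.1 p.2 + s * E p.1 p.2 + s ^ 2 * F p.1 p.2 -
        M p.1 p.2) ^ 2 := by
    funext s
    simp only [risk, hexp, Matrix.add_apply, Matrix.smul_apply, smul_eq_mul]
  rw [h2]
  have h3 : ∀ p ∈ S, HasDerivAt (fun s : ℝ => ((factorA θ * factorB θ) p.1 p.2 + s * E p.1 p.2 +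
      s ^ 2 * F p.1 p.2 - M p.1 p.2) ^ 2)
      (2 * ((factorA θ * factorB θ - M) p.1 p.2 * E p.1 p.2)) 0 := by
    intro p _
    have := ((((((hasDerivAt_id (0 : ℝ)).mul_const (E p.1 p.2)).const_add
      ((factorA θ * factorB θ) p.1 p.2)).add (((hasDerivAt_id (0 : ℝ)).pow 2).mul_const
      (F p.1 p.2))).sub_const (M p.1 p.2)).pow 2)
    refine this.congr_deriv ?_
    simp
    ring
  refine ((HasDerivAt.fun_sum h3).const_mul (1 / (S.card : ℝ))).congr_deriv ?_
  rw [riskGrad, inner_smul_left, inner_param, factorA_ofFactors, factorB_ofFactors,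
    frob_mul_transpose_left, frob_transpose_mul_left, ← frob_add_right, ← hE,
    residualMatrix_eq_observed, frob_observed_left, ← Finset.mul_sum]
  simp only [conj_trivial]
  ring

/-- Along the line `θ + s • v` the gradient is a cubic polynomial in `s`; the Hessian applied to `v`
is its linear coefficient. -/
theorem hessian_risk (θ v : Param d) :
    hessian (risk S M) θ v = (2 / (S.card : ℝ)) • ofFactors
      (observed S (factorA v * factorB θ + factorA θ * factorB v) * (factorB θ)ᵀ +
        residualMatrix S M θ * (factorB v)ᵀ)
      ((factorA θ)ᵀ * observed S (factorA v * factorB θ + factorA θ * factorB v) +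
        (factorA v)ᵀ * residualMatrix S M θ) := by
  have hd : DifferentiableAt ℝ (gradient (risk S M)) θ :=
    (contDiff_gradient (n := 1) (contDiff_risk S M)).differentiable one_ne_zero θ
  have h1 : HasDerivAt (fun s : ℝ => gradient (risk S M) (θ + s • v))
      (hessian (risk S M) θ v) 0 := hd.hasFDerivAt.hasLineDerivAt v
  refine h1.unique ?_
  set E := factorA v * factorB θ + factorA θ * factorB v with hE
  set F := factorA v * factorB v with hF
  set D := residualMatrix S M θ with hD
  have hres : ∀ s : ℝ, residualMatrix S M (θ + s • v) =
      D + s • observed S E + s ^ 2 • observed S F := by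
    intro s
    rw [hD, residualMatrix_eq_observed, residualMatrix_eq_observed, ← observed_smul,
      ← observed_smul, ← observed_add, ← observed_add]
    congr 1
    simp only [factorA_add, factorB_add, factorA_smul, factorB_smul, hE, hF, add_mul, mul_add,
      smul_add, Matrix.smul_mul, Matrix.mul_smul, smul_smul, pow_two]
    abel
  set G₀ := ofFactors (D * (factorB θ)ᵀ) ((factorA θ)ᵀ * D) with hG₀
  set G₁ := ofFactors (observed S E * (factorB θ)ᵀ + D * (factorB v)ᵀ)
    ((factorA θ)ᵀ * observed S E + (factorA v)ᵀ * D) with hG₁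
  set G₂ := ofFactors (observed S F * (factorB θ)ᵀ + observed S E * (factorB v)ᵀ)
    ((factorA θ)ᵀ * observed S F + (factorA v)ᵀ * observed S E) with hG₂
  set G₃ := ofFactors (observed S F * (factorB v)ᵀ) ((factorA v)ᵀ * observed S F) with hG₃
  have hexp : (fun s : ℝ => gradient (risk S M) (θ + s • v)) = fun s =>
      (2 / (S.card : ℝ)) • (G₀ + s • G₁ + s ^ 2 • G₂ + s ^ 3 • G₃) := by
    funext s
    rw [gradient_risk, riskGrad, hres]
    congr 1
    refine param_ext ?_ ?_
    · simp only [hG₀, hG₁, hG₂, hG₃, factorA_add, factorB_add, factorA_smul, factorB_smul,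
        factorA_ofFactors, Matrix.transpose_add, Matrix.transpose_smul, add_mul, mul_add,
        Matrix.smul_mul, Matrix.mul_smul, smul_add, smul_smul]
      module
    · simp only [hG₀, hG₁, hG₂, hG₃, factorA_add, factorB_add, factorA_smul, factorB_smul,
        factorB_ofFactors, Matrix.transpose_add, Matrix.transpose_smul, add_mul, mul_add,
        Matrix.smul_mul, Matrix.mul_smul, smul_add, smul_smul]
      module
  rw [hexp]
  have hid := hasDerivAt_id (0 : ℝ)
  have := (((((hid.smul_const G₁).const_add G₀).add ((hid.pow 2).smul_const G₂)).add
    ((hid.pow 3).smul_const G₃)).const_smul (2 / (S.card : ℝ)))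
  refine this.congr_deriv ?_
  simp

theorem inner_hessian_risk (θ v v' : Param d) :
    inner ℝ (hessian (risk S M) θ v) v' = (2 / (S.card : ℝ)) *
      (frob (observed S (factorA v * factorB θ + factorA θ * factorB v))
        (factorA v' * factorB θ + factorA θ * factorB v') +
      frob (residualMatrix S M θ) (factorA v' * factorB v + factorA v * factorB v')) := by
  rw [hessian_risk, inner_smul_left, inner_param, factorA_ofFactors, factorB_ofFactors,
    frob_add_left, frob_add_left, frob_mul_transpose_left, frob_transpose_mul_left,
    frob_mul_transpose_left, frob_transpose_mul_left, frob_add_right, frob_add_right]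
  simp only [conj_trivial]
  ring

theorem isSymmetric_hessian_risk (θ : Param d) :
    ((-hessian (risk S M) θ : Param d →L[ℝ] Param d) : Param d →ₗ[ℝ] Param d).IsSymmetric := by
  intro v v'
  simp only [ContinuousLinearMap.coe_coe, _root_.neg_apply, inner_neg_left,
    inner_neg_right]
  rw [real_inner_comm (hessian (risk S M) θ v') v, inner_hessian_risk, inner_hessian_risk,
    frob_observed_symm, add_comm (factorA v' * factorB v)]

end Parameters

/-! ### The top eigenspace of the negative Hessian. -/

section Spectrum

variable {d : ℕ}

/-- The symmetric dilation `[[0, -D], [-Dᵀ, 0]]` of `D`. -/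
def dilation (D : Matrix (Fin d) (Fin d) ℝ) : Matrix (Fin d ⊕ Fin d) (Fin d ⊕ Fin d) ℝ :=
  Matrix.fromBlocks 0 (-D) (-Dᵀ) 0

theorem dilation_mulVec (D : Matrix (Fin d) (Fin d) ℝ) (p q : Fin d → ℝ) :
    dilation D *ᵥ Sum.elim p q = Sum.elim (-(D *ᵥ q)) (-(Dᵀ *ᵥ p)) := by
  rw [dilation, Matrix.fromBlocks_mulVec]
  simp [Matrix.neg_mulVec, Function.comp_def]

theorem dotProduct_dilation_mulVec (D : Matrix (Fin d) (Fin d) ℝ) (p q : Fin d → ℝ) :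
    Sum.elim p q ⬝ᵥ dilation D *ᵥ Sum.elim p q = -2 * (p ⬝ᵥ D *ᵥ q) := by
  rw [dilation_mulVec, sumElim_dotProduct_sumElim, dotProduct_neg, dotProduct_neg,
    Matrix.mulVec_transpose, dotProduct_comm q, ← Matrix.dotProduct_mulVec]
  ring

theorem isHermitian_dilation (D : Matrix (Fin d) (Fin d) ℝ) : (dilation D).IsHermitian := by
  rw [Matrix.IsHermitian, dilation, Matrix.conjTranspose_eq_transpose_of_trivial,
    Matrix.fromBlocks_transpose]
  simp

/-- The largest eigenvalue of a real symmetric matrix bounds its quadratic form. -/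
theorem posSemidef_smul_one_sub {n : Type*} [Fintype n] [DecidableEq n] {N : Matrix n n ℝ}
    (hN : N.IsHermitian) {σ : ℝ}
    (hσ : σ ∈ upperBounds {μ : ℝ | Module.End.HasEigenvalue (Matrix.toLin' N) μ}) :
    (σ • (1 : Matrix n n ℝ) - N).PosSemidef := by
  have hH : (σ • (1 : Matrix n n ℝ) - N).IsHermitian := by
    rw [Matrix.IsHermitian, Matrix.conjTranspose_sub, hN.eq]
    simp
  rw [hH.posSemidef_iff_eigenvalues_nonneg]
  intro i
  have h := hH.mulVec_eigenvectorBasis i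
  set x : n → ℝ := ⇑(hH.eigenvectorBasis i) with hx
  have hx0 : x ≠ 0 := by
    intro h0
    apply hH.eigenvectorBasis.orthonormal.ne_zero i
    ext j
    exact congrFun h0 j
  rw [Matrix.sub_mulVec, Matrix.smul_mulVec, Matrix.one_mulVec] at h
  have h1 : N *ᵥ x = (σ - hH.eigenvalues i) • x := by
    rw [sub_smul, ← h]; abel
  have h2 := hσ (Module.End.hasEigenvalue_of_hasEigenvector (f := Matrix.toLin' N) (x := x)
    ⟨Module.End.mem_eigenspace_iff.2 (by rw [Matrix.toLin'_apply, h1]), hx0⟩)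
  simp only [Pi.zero_apply]
  linarith

theorem exists_top_singular_vector {D : Matrix (Fin d) (Fin d) ℝ} (hD : UniqueTopSingularValue D) :
    ∃ (σ : ℝ) (p q : Fin d → ℝ), 0 < σ ∧ (σ • 1 - dilation D).PosSemidef ∧ p ≠ 0 ∧ q ≠ 0 ∧
      D *ᵥ q = -(σ • p) ∧ Dᵀ *ᵥ p = -(σ • q) ∧
      ∀ x, dilation D *ᵥ x = σ • x → ∃ r : ℝ, x = r • Sum.elim p q := by
  obtain ⟨σ, ⟨hσ, hmax⟩, hone⟩ := hD
  change Module.End.HasEigenvalue (Matrix.toLin' (dilation D)) σ at hσ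
  change Module.finrank ℝ (Module.End.eigenspace (Matrix.toLin' (dilation D)) σ) = 1 at hone
  have hpsd := posSemidef_smul_one_sub (isHermitian_dilation D) hmax
  have hq : ∀ x, x ⬝ᵥ (σ • 1 - dilation D) *ᵥ x = σ * (x ⬝ᵥ x) - x ⬝ᵥ dilation D *ᵥ x := by
    intro x
    rw [Matrix.sub_mulVec, Matrix.smul_mulVec, Matrix.one_mulVec, dotProduct_sub, dotProduct_smul,
      smul_eq_mul]
  -- If σ ≤ 0, positivity at both `(p, q)` and `(p, -q)` forces the form of `σ • 1 - dilation D` to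
  -- vanish identically. The eigenspace would then be everything, of dimension 2d, which is not 1.
  have hpos : 0 < σ := by
    by_contra hneg
    have hall : Module.End.eigenspace (Matrix.toLin' (dilation D)) σ = ⊤ := by
      rw [eq_top_iff]
      intro x _
      obtain ⟨p, q, rfl⟩ : ∃ p q : Fin d → ℝ, x = Sum.elim p q :=
        ⟨x ∘ Sum.inl, x ∘ Sum.inr, (Sum.elim_comp_inl_inr x).symm⟩
      have h1 := hpsd.dotProduct_mulVec_nonneg (Sum.elim p q)
      have h2 := hpsd.dotProduct_mulVec_nonneg (Sum.elim p (-q))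
      rw [star_trivial, hq, dotProduct_dilation_mulVec] at h1 h2
      rw [Matrix.mulVec_neg, dotProduct_neg] at h2
      have h3 : Sum.elim p (-q) ⬝ᵥ Sum.elim p (-q) = Sum.elim p q ⬝ᵥ Sum.elim p q := by
        rw [sumElim_dotProduct_sumElim, sumElim_dotProduct_sumElim]
        simp
      rw [h3] at h2
      have h4 : 0 ≤ Sum.elim p q ⬝ᵥ Sum.elim p q := by
        simpa using dotProduct_star_self_nonneg (Sum.elim p q)
      have h5 : σ * (Sum.elim p q ⬝ᵥ Sum.elim p q) ≤ 0 :=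
        mul_nonpos_of_nonpos_of_nonneg (not_lt.1 hneg) h4
      have h6 : (σ • 1 - dilation D) *ᵥ Sum.elim p q = 0 := by
        rw [← hpsd.dotProduct_mulVec_zero_iff, star_trivial, hq, dotProduct_dilation_mulVec]
        linarith
      rw [Matrix.sub_mulVec, Matrix.smul_mulVec, Matrix.one_mulVec, sub_eq_zero] at h6
      rw [Module.End.mem_eigenspace_iff, Matrix.toLin'_apply, h6]
    rw [hall, finrank_top, Module.finrank_fintype_fun_eq_card, Fintype.card_sum] at hone
    omega
  obtain ⟨u, hu⟩ := hσ.exists_hasEigenvector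
  obtain ⟨p, q, rfl⟩ : ∃ p q : Fin d → ℝ, u = Sum.elim p q :=
    ⟨u ∘ Sum.inl, u ∘ Sum.inr, (Sum.elim_comp_inl_inr u).symm⟩
  have hu1 := hu.apply_eq_smul
  rw [Matrix.toLin'_apply, dilation_mulVec] at hu1
  have h1 : D *ᵥ q = -(σ • p) := by
    rw [← neg_eq_iff_eq_neg]
    funext i
    exact congrFun hu1 (Sum.inl i)
  have h2 : Dᵀ *ᵥ p = -(σ • q) := by
    rw [← neg_eq_iff_eq_neg]
    funext i
    exact congrFun hu1 (Sum.inr i)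
  have hne : ∀ x : Fin d → ℝ, -(σ • x) = 0 → x = 0 := fun x hx => by
    simpa [hpos.ne'] using hx
  refine ⟨σ, p, q, hpos, hpsd, ?_, ?_, h1, h2, ?_⟩
  · rintro rfl
    rw [Matrix.mulVec_zero] at h2
    rw [hne q h2.symm] at hu
    exact hu.2 (by simp)
  · rintro rfl
    rw [Matrix.mulVec_zero] at h1
    rw [hne p h1.symm] at hu
    exact hu.2 (by simp)
  · intro x hx
    have hmem : x ∈ Module.End.eigenspace (Matrix.toLin' (dilation D)) σ := by
      rw [Module.End.mem_eigenspace_iff, Matrix.toLin'_apply, hx]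
    obtain ⟨r, hr⟩ := (finrank_eq_one_iff_of_nonzero' (⟨Sum.elim p q, hu.1⟩ :
      Module.End.eigenspace (Matrix.toLin' (dilation D)) σ)
      (fun h => hu.2 (congrArg Subtype.val h))).1 hone ⟨x, hmem⟩
    exact ⟨r, (congrArg Subtype.val hr).symm⟩

/-- The parameters whose augmented matrix is `Sum.elim p q ⊗ w`. -/
def rankOneParam (p q w : Fin d → ℝ) : Param d :=
  ofFactors (Matrix.vecMulVec p w) (Matrix.vecMulVec w q)

theorem norm_sq_param (v : Param d) :
    ‖v‖ ^ 2 = ∑ l, (augMatrix v).col l ⬝ᵥ (augMatrix v).col l := by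
  rw [← real_inner_self_eq_norm_sq, inner_param, frob, frob, Finset.sum_comm,
    ← Finset.sum_add_distrib]
  refine Finset.sum_congr rfl fun l _ => ?_
  rw [dotProduct, Fintype.sum_sum_type]
  rfl

theorem sum_col_dotProduct_dilation (D : Matrix (Fin d) (Fin d) ℝ) (v : Param d) :
    ∑ l, (augMatrix v).col l ⬝ᵥ dilation D *ᵥ (augMatrix v).col l =
      -2 * frob D (factorA v * factorB v) := by
  have h : ∀ l, (augMatrix v).col l =
      Sum.elim (fun i => factorA v i l) (fun j => factorB v l j) := by
    intro l
    funext s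
    rcases s with i | j <;> rfl
  simp only [h, dotProduct_dilation_mulVec, ← Finset.mul_sum]
  congr 1
  simp only [frob, dotProduct, Matrix.mulVec, Matrix.mul_apply, Finset.mul_sum]
  rw [Finset.sum_comm]
  refine Finset.sum_congr rfl fun i _ => ?_
  rw [Finset.sum_comm]
  refine Finset.sum_congr rfl fun j _ => Finset.sum_congr rfl fun l _ => ?_
  ring

variable {S : Finset (Fin d × Fin d)} {M : Matrix (Fin d) (Fin d) ℝ} {θ : Param d} {σ : ℝ}
  {p q : Fin d → ℝ}

/-- The residual part of the second variation decouples over the columns of the augmented matrix,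
each contributing the form of the dilation; what remains of the Hessian is a sum of squares over
observed positions. -/
theorem sum_col_dotProduct_smul_one_sub (hS : S.Nonempty) (v : Param d) :
    ∑ l, (augMatrix v).col l ⬝ᵥ (σ • 1 - dilation (residualMatrix S M θ)) *ᵥ (augMatrix v).col l =
      σ * ‖v‖ ^ 2 + (S.card : ℝ) / 2 * inner ℝ (hessian (risk S M) θ v) v -
      frob (observed S (factorA v * factorB θ + factorA θ * factorB v))
        (factorA v * factorB θ + factorA θ * factorB v) := by
  have hc : (S.card : ℝ) ≠ 0 := by exact_mod_cast hS.card_pos.ne'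
  have h : ∀ x : Fin d ⊕ Fin d → ℝ, x ⬝ᵥ (σ • 1 - dilation (residualMatrix S M θ)) *ᵥ x =
      σ * (x ⬝ᵥ x) - x ⬝ᵥ dilation (residualMatrix S M θ) *ᵥ x := by
    intro x
    rw [Matrix.sub_mulVec, Matrix.smul_mulVec, Matrix.one_mulVec, dotProduct_sub, dotProduct_smul,
      smul_eq_mul]
  simp only [h]
  rw [Finset.sum_sub_distrib, ← Finset.mul_sum, ← norm_sq_param, sum_col_dotProduct_dilation,
    inner_hessian_risk, frob_add_right (residualMatrix S M θ)]
  field_simp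
  ring

theorem nonempty_of_residualMatrix_mulVec (hσ : 0 < σ) (hp : p ≠ 0)
    (hpq : residualMatrix S M θ *ᵥ q = -(σ • p)) : S.Nonempty := by
  rw [Finset.nonempty_iff_ne_empty]
  rintro rfl
  have : residualMatrix ∅ M θ = 0 := by
    ext i j
    simp [residualMatrix]
  rw [this, Matrix.zero_mulVec, eq_comm, neg_eq_zero] at hpq
  exact hp (by simpa [hσ.ne'] using hpq)

/-- Directions orthogonal to the rows of `A` and the columns of `B` that point along the top
singular vectors of the residual are eigenvectors of the Hessian. -/
theorem hessian_rankOneParam (hp : residualMatrix S M θ *ᵥ q = -(σ • p))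
    (hq : (residualMatrix S M θ)ᵀ *ᵥ p = -(σ • q)) {w : Fin d → ℝ}
    (hA : factorA θ *ᵥ w = 0) (hB : w ᵥ* factorB θ = 0) :
    (-hessian (risk S M) θ) (rankOneParam p q w) =
      (2 / (S.card : ℝ) * σ) • rankOneParam p q w := by
  rw [_root_.neg_apply, hessian_risk]
  have h1 : factorA (rankOneParam p q w) * factorB θ +
      factorA θ * factorB (rankOneParam p q w) = 0 := by
    rw [rankOneParam, factorA_ofFactors, factorB_ofFactors, Matrix.vecMulVec_mul,
      Matrix.mul_vecMulVec, hA, hB]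
    simp
  have h2 : observed S (0 : Matrix (Fin d) (Fin d) ℝ) = 0 := by
    ext i j
    simp [observed]
  have h3 : residualMatrix S M θ * (factorB (rankOneParam p q w))ᵀ =
      -(σ • Matrix.vecMulVec p w) := by
    rw [rankOneParam, factorB_ofFactors, Matrix.transpose_vecMulVec, Matrix.mul_vecMulVec, hp,
      Matrix.neg_vecMulVec, Matrix.smul_vecMulVec]
  have h4 : (factorA (rankOneParam p q w))ᵀ * residualMatrix S M θ =
      -(σ • Matrix.vecMulVec w q) := by
    rw [rankOneParam, factorA_ofFactors, Matrix.transpose_vecMulVec, Matrix.vecMulVec_mul,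
      ← Matrix.mulVec_transpose, hq, Matrix.vecMulVec_neg, Matrix.vecMulVec_smul]
  rw [h1, h2, h3, h4]
  refine param_ext ?_ ?_
  · simp [rankOneParam, smul_smul]
  · simp [rankOneParam, smul_smul]

theorem le_of_hasEigenvector_neg_hessian
    (hS : S.Nonempty) (hpsd : (σ • 1 - dilation (residualMatrix S M θ)).PosSemidef) {lam : ℝ}
    {v : Param d} (hv : (-hessian (risk S M) θ) v = lam • v) (hv0 : v ≠ 0) :
    lam ≤ 2 / (S.card : ℝ) * σ := by
  have hc : (0 : ℝ) < S.card := by exact_mod_cast hS.card_pos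
  have h1 := sum_col_dotProduct_smul_one_sub (σ := σ) (M := M) (θ := θ) hS v
  have h2 := frob_observed_self_nonneg S (factorA v * factorB θ + factorA θ * factorB v)
  have h3 : 0 ≤ ∑ l, (augMatrix v).col l ⬝ᵥ
      (σ • 1 - dilation (residualMatrix S M θ)) *ᵥ (augMatrix v).col l :=
    Finset.sum_nonneg fun l _ => by
      simpa using hpsd.dotProduct_mulVec_nonneg ((augMatrix v).col l)
  have h4 : hessian (risk S M) θ v = -(lam • v) := by
    rw [← hv, _root_.neg_apply, neg_neg]
  rw [h4, inner_neg_left, inner_smul_left, real_inner_self_eq_norm_sq, conj_trivial] at h1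
  have h5 : 0 < ‖v‖ ^ 2 := by positivity
  have h6 : 0 ≤ (σ - (S.card : ℝ) / 2 * lam) * ‖v‖ ^ 2 := by linarith
  have h7 : 0 ≤ σ - (S.card : ℝ) / 2 * lam := nonneg_of_mul_nonneg_left h6 h5
  have h8 : 2 / (S.card : ℝ) * σ - lam = 2 / (S.card : ℝ) * (σ - (S.card : ℝ) / 2 * lam) := by
    field_simp
  have h9 : 0 ≤ 2 / (S.card : ℝ) * (σ - (S.card : ℝ) / 2 * lam) := by positivity
  linarith

/-- Equality in the eigenvalue bound forces each nonnegative column term to vanish, so every column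
is a top eigenvector of the dilation, hence a multiple of `(p, q)`. The multipliers form `w`. -/
theorem exists_eq_rankOneParam
    (hS : S.Nonempty) (hpsd : (σ • 1 - dilation (residualMatrix S M θ)).PosSemidef)
    (hone : ∀ x, dilation (residualMatrix S M θ) *ᵥ x = σ • x → ∃ r : ℝ, x = r • Sum.elim p q)
    {v : Param d} (hv : (-hessian (risk S M) θ) v = (2 / (S.card : ℝ) * σ) • v) :
    ∃ w, v = rankOneParam p q w := by
  have hc : (0 : ℝ) < S.card := by exact_mod_cast hS.card_pos
  have h1 := sum_col_dotProduct_smul_one_sub (σ := σ) (M := M) (θ := θ) hS v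
  have h2 := frob_observed_self_nonneg S (factorA v * factorB θ + factorA θ * factorB v)
  have h3 : ∀ l ∈ Finset.univ, 0 ≤ (augMatrix v).col l ⬝ᵥ
      (σ • 1 - dilation (residualMatrix S M θ)) *ᵥ (augMatrix v).col l := fun l _ => by
    simpa using hpsd.dotProduct_mulVec_nonneg ((augMatrix v).col l)
  have h4 : hessian (risk S M) θ v = -((2 / (S.card : ℝ) * σ) • v) := by
    rw [← hv, _root_.neg_apply, neg_neg]
  rw [h4, inner_neg_left, inner_smul_left, real_inner_self_eq_norm_sq, conj_trivial] at h1
  have h5 : (S.card : ℝ) / 2 * -(2 / (S.card : ℝ) * σ * ‖v‖ ^ 2) = -(σ * ‖v‖ ^ 2) := by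
    field_simp
  have h6 : ∑ l, (augMatrix v).col l ⬝ᵥ
      (σ • 1 - dilation (residualMatrix S M θ)) *ᵥ (augMatrix v).col l = 0 :=
    le_antisymm (by linarith) (Finset.sum_nonneg h3)
  have h7 : ∀ l, ∃ r : ℝ, (augMatrix v).col l = r • Sum.elim p q := by
    intro l
    have h8 := (Finset.sum_eq_zero_iff_of_nonneg h3).1 h6 l (Finset.mem_univ l)
    have h9 := (hpsd.dotProduct_mulVec_zero_iff ((augMatrix v).col l)).1 (by simpa using h8)
    rw [Matrix.sub_mulVec, Matrix.smul_mulVec, Matrix.one_mulVec, sub_eq_zero] at h9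
    exact hone _ h9.symm
  choose w hw using h7
  refine ⟨w, param_ext ?_ ?_⟩
  · ext i l
    have := congrFun (hw l) (Sum.inl i)
    rw [rankOneParam, factorA_ofFactors, Matrix.vecMulVec_apply, mul_comm]
    exact this
  · ext l j
    have := congrFun (hw l) (Sum.inr j)
    rw [rankOneParam, factorB_ofFactors, Matrix.vecMulVec_apply]
    exact this

end Spectrum

/-! ### Rank bounds and rank jumps under perturbation. -/

section Rank

theorem card_le_rank {m n : Type*} [Fintype m] [Fintype n] {X : Matrix m n ℝ} {r : ℕ}
    {f : Fin r → n → ℝ} (hf : LinearIndependent ℝ f)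
    (hmem : ∀ i, f i ∈ Submodule.span ℝ (Set.range X.row)) : r ≤ X.rank := by
  rw [X.rank_eq_finrank_span_row]
  have h1 := finrank_span_eq_card hf
  rw [Fintype.card_fin] at h1
  rw [← h1]
  exact Submodule.finrank_mono (Submodule.span_le.2 (Set.range_subset_iff.2 hmem))

theorem rank_le_rank_add_one {m n : Type*} [Fintype m] [Fintype n] {X Y : Matrix m n ℝ}
    {w : n → ℝ} (h : ∀ i, Y i ∈ Submodule.span ℝ (Set.range X.row) ⊔ Submodule.span ℝ {w}) :
    Y.rank ≤ X.rank + 1 := by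
  rw [Y.rank_eq_finrank_span_row, X.rank_eq_finrank_span_row]
  refine (Submodule.finrank_mono (Submodule.span_le.2 (Set.range_subset_iff.2 h))).trans ?_
  refine (Submodule.finrank_add_le_finrank_add_finrank _ _).trans ?_
  gcongr
  exact (finrank_span_le_card {w}).trans (by simp)

/-- A perturbation of `X` whose leading part is `u ⊗ w`, with `u` orthogonal to the columns of `X`
and `w` not in the row space of `X`, has larger rank than `X`. -/
theorem eventually_rank_add_one_le {m n ι : Type*} [Fintype m] [Fintype n] {l : Filter ι}
    {X : Matrix m n ℝ} {Y : ι → Matrix m n ℝ} {ε : ι → ℝ} {u : m → ℝ} {w : n → ℝ}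
    (hY : Tendsto Y l (𝓝 X)) (h : Tendsto (fun t => ε t • (Y t - X)) l (𝓝 (Matrix.vecMulVec u w)))
    (hu : u ᵥ* X = 0) (hu0 : u ≠ 0) (hw : w ∉ Submodule.span ℝ (Set.range X.row)) :
    ∀ᶠ t in l, X.rank + 1 ≤ (Y t).rank := by
  obtain ⟨f, hf, hspan, hli⟩ : ∃ f : Fin X.rank → n → ℝ, (∀ i, f i ∈ Set.range X.row) ∧
      Submodule.span ℝ (Set.range f) = Submodule.span ℝ (Set.range X.row) ∧
      LinearIndependent ℝ f := by
    rw [X.rank_eq_finrank_span_row]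
    exact Submodule.exists_fun_fin_finrank_span_eq ℝ (Set.range X.row)
  choose i hi using hf
  have hvec : Continuous fun Z : Matrix m n ℝ => u ᵥ* Z := by
    unfold Matrix.vecMul dotProduct
    fun_prop
  have hlim1 : Tendsto (fun t => ε t • (u ᵥ* Y t)) l (𝓝 ((u ⬝ᵥ u) • w)) := by
    have h1 := (hvec.tendsto _).comp h
    rw [Matrix.vecMul_vecMulVec] at h1
    refine h1.congr fun t => ?_
    rw [Function.comp_apply, Matrix.vecMul_smul, Matrix.vecMul_sub, hu, sub_zero]
  have huu : u ⬝ᵥ u ≠ 0 := fun h0 => hu0 (dotProduct_self_eq_zero.1 h0)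
  -- All these vectors lie in the row space of `Y t`. They converge to a basis of the row space of
  -- `X` together with a nonzero multiple of `w`, and linear independence is an open condition.
  have hlim : Tendsto (fun t => (Fin.cons (ε t • (u ᵥ* Y t)) fun r => Y t (i r) :
      Fin (X.rank + 1) → n → ℝ)) l (𝓝 (Fin.cons ((u ⬝ᵥ u) • w) f)) := by
    rw [tendsto_pi_nhds]
    intro r
    refine Fin.cases ?_ (fun r => ?_) r
    · simpa using hlim1
    · simp only [Fin.cons_succ]
      rw [← hi r]
      exact (tendsto_pi_nhds.1 hY) (i r)
  have hlim_li : LinearIndependent ℝ (Fin.cons ((u ⬝ᵥ u) • w) f : Fin (X.rank + 1) → n → ℝ) := by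
    rw [linearIndependent_finCons, hspan]
    refine ⟨hli, fun hmem => hw ?_⟩
    have := Submodule.smul_mem _ (u ⬝ᵥ u)⁻¹ hmem
    rwa [smul_smul, inv_mul_cancel₀ huu, one_smul] at this
  filter_upwards [hlim.eventually hlim_li.eventually] with t ht
  refine card_le_rank ht fun r => ?_
  refine Fin.cases ?_ (fun r => ?_) r
  · rw [Fin.cons_zero]
    refine Submodule.smul_mem _ _ ?_
    rw [Matrix.vecMul_eq_sum]
    exact Submodule.sum_mem _ fun j _ => Submodule.smul_mem _ _ (Submodule.subset_span ⟨j, rfl⟩)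
  · rw [Fin.cons_succ]
    exact Submodule.subset_span ⟨i r, rfl⟩

theorem le_rank_of_injOn {m n : Type*} [Fintype m] [Fintype n] {X : Matrix m n ℝ} {k : ℕ}
    {α : Fin k → n → ℝ} (hα : LinearIndependent ℝ α)
    (h : ∀ v ∈ Submodule.span ℝ (Set.range α), X *ᵥ v = 0 → v = 0) : k ≤ X.rank := by
  have h1 := finrank_span_eq_card hα
  rw [Fintype.card_fin] at h1
  rw [← h1, Matrix.rank]
  refine LinearMap.finrank_le_finrank_of_injective
    (f := (X.mulVecLin.domRestrict (Submodule.span ℝ (Set.range α))).codRestrict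
      (LinearMap.range X.mulVecLin) fun v => ⟨v, rfl⟩) ?_
  rw [injective_iff_map_eq_zero]
  intro v hv
  exact Subtype.ext (h v v.2 (congrArg Subtype.val hv))

end Rank

/-! ### Invariant subspaces and the block attached to the manifold. -/

section Invariance

variable {d k : ℕ} {S : Finset (Fin d × Fin d)} {M : Matrix (Fin d) (Fin d) ℝ}

theorem factorA_add_row (θ η : Param d) (i : Fin d) :
    factorA (θ + η) i = factorA θ i + factorA η i := rfl

theorem factorB_add_col (θ η : Param d) (j : Fin d) :
    (factorB (θ + η))ᵀ j = (factorB θ)ᵀ j + (factorB η)ᵀ j := rfl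

theorem factorA_smul_row (r : ℝ) (θ : Param d) (i : Fin d) :
    factorA (r • θ) i = r • factorA θ i := rfl

theorem factorB_smul_col (r : ℝ) (θ : Param d) (j : Fin d) :
    (factorB (r • θ))ᵀ j = r • (factorB θ)ᵀ j := rfl

/-- The parameters for which every row of `A` and every column of `B` lies in `U`. -/
def rowsIn (U : Submodule ℝ (Fin d → ℝ)) : Submodule ℝ (Param d) where
  carrier := {θ | (∀ i, factorA θ i ∈ U) ∧ ∀ j, (factorB θ)ᵀ j ∈ U}
  add_mem' h h' := ⟨fun i => U.add_mem (h.1 i) (h'.1 i), fun j => U.add_mem (h.2 j) (h'.2 j)⟩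
  zero_mem' := ⟨fun _ => U.zero_mem, fun _ => U.zero_mem⟩
  smul_mem' r _ h := ⟨fun i => U.smul_mem r (h.1 i), fun j => U.smul_mem r (h.2 j)⟩

theorem mem_rowsIn {U : Submodule ℝ (Fin d → ℝ)} {θ : Param d} :
    θ ∈ rowsIn U ↔ (∀ i, factorA θ i ∈ U) ∧ ∀ j, (factorB θ)ᵀ j ∈ U := Iff.rfl

theorem mem_rowsIn_span_augMatrix (θ : Param d) :
    θ ∈ rowsIn (Submodule.span ℝ (Set.range (augMatrix θ).row)) :=
  ⟨fun i => Submodule.subset_span ⟨Sum.inl i, rfl⟩, fun j => Submodule.subset_span ⟨Sum.inr j, rfl⟩⟩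

theorem augMatrix_mem_of_mem_rowsIn {U : Submodule ℝ (Fin d → ℝ)} {θ : Param d}
    (h : θ ∈ rowsIn U) : ∀ i, augMatrix θ i ∈ U := by
  rintro (i | j)
  · exact h.1 i
  · exact h.2 j

theorem factorA_riskGrad_row (θ : Param d) (i : Fin d) :
    factorA (riskGrad S M θ) i =
      (2 / (S.card : ℝ)) • ∑ j, residualMatrix S M θ i j • (factorB θ)ᵀ j := by
  funext l
  simp [riskGrad, Matrix.mul_apply, Finset.sum_apply]

theorem factorB_riskGrad_col (θ : Param d) (j : Fin d) :
    (factorB (riskGrad S M θ))ᵀ j =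
      (2 / (S.card : ℝ)) • ∑ i, residualMatrix S M θ i j • factorA θ i := by
  funext l
  simp [riskGrad, Matrix.mul_apply, Finset.sum_apply, mul_comm]

theorem neg_gradient_mem_rowsIn {U : Submodule ℝ (Fin d → ℝ)} {θ : Param d} (h : θ ∈ rowsIn U) :
    -gradient (risk S M) θ ∈ rowsIn U := by
  refine Submodule.neg_mem _ ?_
  rw [gradient_risk]
  refine ⟨fun i => ?_, fun j => ?_⟩
  · rw [factorA_riskGrad_row]
    exact U.smul_mem _ (U.sum_mem fun j _ => U.smul_mem _ (h.2 j))
  · rw [factorB_riskGrad_col]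
    exact U.smul_mem _ (U.sum_mem fun i _ => U.smul_mem _ (h.1 i))

/-- The increments that vanish on the rows `I` and the columns `J`, and whose other rows and
columns are multiples of `w`. -/
def offBlockMultiples (I J : Set (Fin d)) (w : Fin d → ℝ) : Submodule ℝ (Param d) where
  carrier := {θ | ((∀ i ∈ I, factorA θ i = 0) ∧ ∀ j ∈ J, (factorB θ)ᵀ j = 0) ∧
    θ ∈ rowsIn (Submodule.span ℝ {w})}
  add_mem' h h' := ⟨⟨fun i hi => by
      rw [factorA_add_row, h.1.1 i hi, h'.1.1 i hi, add_zero],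
    fun j hj => by
      rw [factorB_add_col, h.1.2 j hj, h'.1.2 j hj,
        add_zero]⟩, Submodule.add_mem _ h.2 h'.2⟩
  zero_mem' := ⟨⟨fun _ _ => rfl, fun _ _ => rfl⟩, Submodule.zero_mem _⟩
  smul_mem' r _ h := ⟨⟨fun i hi => by
      rw [factorA_smul_row, h.1.1 i hi, smul_zero],
    fun j hj => by
      rw [factorB_smul_col, h.1.2 j hj, smul_zero]⟩,
    Submodule.smul_mem _ r h.2⟩

variable {I J : Set (Fin d)} {θc : Param d}

/-- The increment leaves the factors on the block untouched, so the residual on `I × J` stays zero,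
and no observed position joins the block to its complement. The gradient thus sees only the
complementary rows and columns, which are multiples of `w` because `θc` vanishes there. -/
theorem neg_gradient_mem_offBlockMultiples (hIJ : ∀ i j, (i, j) ∈ S → (i ∈ I ↔ j ∈ J))
    (hA : ∀ i, i ∉ I → factorA θc i = 0) (hB : ∀ j, j ∉ J → (factorB θc)ᵀ j = 0)
    (hres : ∀ i ∈ I, ∀ j ∈ J, residualMatrix S M θc i j = 0) {w : Fin d → ℝ} {v : Param d}
    (hv : v ∈ offBlockMultiples I J w) :
    -gradient (risk S M) (θc + v) ∈ offBlockMultiples I J w := by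
  obtain ⟨⟨hvA, hvB⟩, hvw⟩ := hv
  have hAI : ∀ i ∈ I, factorA (θc + v) i = factorA θc i := fun i hi => by
    rw [factorA_add_row, hvA i hi, add_zero]
  have hBJ : ∀ j ∈ J, (factorB (θc + v))ᵀ j = (factorB θc)ᵀ j := fun j hj => by
    rw [factorB_add_col, hvB j hj, add_zero]
  have hAI' : ∀ i, i ∉ I → factorA (θc + v) i ∈ Submodule.span ℝ {w} := fun i hi => by
    rw [factorA_add_row, hA i hi, zero_add]
    exact hvw.1 i
  have hBJ' : ∀ j, j ∉ J → (factorB (θc + v))ᵀ j ∈ Submodule.span ℝ {w} := fun j hj => by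
    rw [factorB_add_col, hB j hj, zero_add]
    exact hvw.2 j
  have hres' : ∀ i ∈ I, ∀ j ∈ J, residualMatrix S M (θc + v) i j = 0 := by
    intro i hi j hj
    rw [← hres i hi j hj]
    have h1 : (factorA (θc + v) * factorB (θc + v)) i j = (factorA θc * factorB θc) i j := by
      have h2 := hBJ j hj
      rw [Matrix.mul_apply', Matrix.mul_apply', hAI i hi]
      exact congrArg (factorA θc i ⬝ᵥ ·) h2
    simp only [residualMatrix, Matrix.of_apply, h1]
  have hoff : ∀ i j, ¬(i ∈ I ↔ j ∈ J) → residualMatrix S M (θc + v) i j = 0 := by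
    intro i j h
    simp only [residualMatrix, Matrix.of_apply]
    rw [if_neg fun hij => h (hIJ i j hij)]
  have hzero : ∀ i j, (i ∈ I ∨ j ∈ J) → residualMatrix S M (θc + v) i j = 0 := by
    intro i j h
    by_cases hi : i ∈ I <;> by_cases hj : j ∈ J
    · exact hres' i hi j hj
    · exact hoff i j (by tauto)
    · exact hoff i j (by tauto)
    · tauto
  refine Submodule.neg_mem _ ?_
  rw [gradient_risk]
  have hAzero : ∀ i ∈ I, factorA (riskGrad S M (θc + v)) i = 0 := fun i hi => by
    rw [factorA_riskGrad_row, Finset.sum_eq_zero fun j _ => by rw [hzero i j (Or.inl hi), zero_smul],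
      smul_zero]
  have hBzero : ∀ j ∈ J, (factorB (riskGrad S M (θc + v)))ᵀ j = 0 := fun j hj => by
    rw [factorB_riskGrad_col, Finset.sum_eq_zero fun i _ => by rw [hzero i j (Or.inr hj), zero_smul],
      smul_zero]
  refine ⟨⟨hAzero, hBzero⟩, fun i => ?_, fun j => ?_⟩
  · rw [factorA_riskGrad_row]
    refine Submodule.smul_mem _ _ (Submodule.sum_mem _ fun j _ => ?_)
    by_cases hj : j ∈ J
    · rw [hzero i j (Or.inr hj), zero_smul]
      exact Submodule.zero_mem _
    · exact Submodule.smul_mem _ _ (hBJ' j hj)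
  · rw [factorB_riskGrad_col]
    refine Submodule.smul_mem _ _ (Submodule.sum_mem _ fun i _ => ?_)
    by_cases hi : i ∈ I
    · rw [hzero i j (Or.inl hi), zero_smul]
      exact Submodule.zero_mem _
    · exact Submodule.smul_mem _ _ (hAI' i hi)

/-- Both kinds of invariant manifolds are cut out of `Omega α` by a set `I` of rows and a set `J`
of columns that no observed position separates. -/
theorem IsRankInvariantManifold.exists_block {Ω : Set (Param d)}
    (hΩ : IsRankInvariantManifold S k Ω) :
    ∃ (α : Fin k → Fin d → ℝ) (I J : Set (Fin d)), LinearIndependent ℝ α ∧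
      (∀ i j, (i, j) ∈ S → (i ∈ I ↔ j ∈ J)) ∧
      ∀ θ, θ ∈ Ω ↔ θ ∈ rowsIn (Submodule.span ℝ (Set.range α)) ∧
        (∀ i, i ∉ I → factorA θ i = 0) ∧ ∀ j, j ∉ J → (factorB θ)ᵀ j = 0 := by
  obtain ⟨α, hα, rfl | ⟨L, rfl⟩⟩ := hΩ
  · exact ⟨α, Set.univ, Set.univ, hα, by simp, fun θ => by simp [Omega, mem_rowsIn]⟩
  · refine ⟨α, compRows L, compCols L, hα, fun i j hij => ?_, fun θ => Iff.rfl⟩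
    have hadj : (bipartiteGraph S).Adj (Sum.inl i) (Sum.inr j) := by
      rw [bipartiteGraph, SimpleGraph.fromRel_adj]
      exact ⟨by simp, Or.inl ⟨i, j, hij, rfl, rfl⟩⟩
    have hi : Sum.inl i ∈ (bipartiteGraph S).support := ⟨_, hadj⟩
    have hj : Sum.inr j ∈ (bipartiteGraph S).support := ⟨_, hadj.symm⟩
    have hcomp : (observationGraph S).connectedComponentMk ⟨Sum.inl i, hi⟩ =
        (observationGraph S).connectedComponentMk ⟨Sum.inr j, hj⟩ := by
      apply SimpleGraph.ConnectedComponent.connectedComponentMk_eq_of_adj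
      exact hadj
    constructor
    · rintro ⟨_, h⟩
      exact ⟨hj, hcomp ▸ h⟩
    · rintro ⟨_, h⟩
      exact ⟨hi, hcomp.trans h⟩

theorem eq_zero_of_forall_add_mul_nonneg {a b : ℝ} (h : ∀ s : ℝ, 0 ≤ a + s * b) : b = 0 := by
  by_contra hb
  have h1 := h (-(a + 1) / b)
  rw [div_mul_cancel₀ _ hb] at h1
  linarith

theorem frob_vecMulVec (D : Matrix (Fin d) (Fin d) ℝ) (i j : Fin d) :
    frob D (Matrix.vecMulVec (Pi.single i 1) (Pi.single j 1)) = D i j := by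
  rw [frob, Finset.sum_eq_single i, Finset.sum_eq_single j]
  · simp [Matrix.vecMulVec_apply]
  · intro j' _ hj'
    simp [Matrix.vecMulVec_apply, hj']
  · simp
  · intro i' _ hi'
    simp [Matrix.vecMulVec_apply, hi']
  · simp

/-- At a second-order stationary point the two factors are injective on the span of `α`, unless the
residual vanishes on the whole block. -/
theorem injOn_span_of_residual_ne_zero {U : Submodule ℝ (Fin d → ℝ)} {i₀ j₀ : Fin d}
    (hi₀ : i₀ ∈ I) (hj₀ : j₀ ∈ J) (hres : residualMatrix S M θc i₀ j₀ ≠ 0) (hS : S.Nonempty)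
    (hsos : ∀ v ∈ rowsIn U, (∀ i, i ∉ I → factorA v i = 0) → (∀ j, j ∉ J → (factorB v)ᵀ j = 0) →
      0 ≤ inner ℝ v (hessian (risk S M) θc v)) {x : Fin d → ℝ} (hx : x ∈ U)
    (h0 : factorA θc *ᵥ x = 0 ∨ (factorB θc)ᵀ *ᵥ x = 0) : x = 0 := by
  have hc : (0 : ℝ) < S.card := by exact_mod_cast hS.card_pos
  have hc2 : 0 < 2 / (S.card : ℝ) := by positivity
  -- Test the Hessian on A-part `r e_{i₀} xᵀ` and B-part `s x e_{j₀}ᵀ`, whose product isolates the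
  -- residual entry at `(i₀, j₀)`.
  have hquad : ∀ r s : ℝ, 0 ≤ frob
      (observed S (r • Matrix.vecMulVec (Pi.single i₀ 1) ((factorB θc)ᵀ *ᵥ x) +
        s • Matrix.vecMulVec (factorA θc *ᵥ x) (Pi.single j₀ 1)))
      (r • Matrix.vecMulVec (Pi.single i₀ 1) ((factorB θc)ᵀ *ᵥ x) +
        s • Matrix.vecMulVec (factorA θc *ᵥ x) (Pi.single j₀ 1)) +
      2 * (r * s) * (x ⬝ᵥ x) * residualMatrix S M θc i₀ j₀ := by
    intro r s
    have h1 := hsos (ofFactors (r • Matrix.vecMulVec (Pi.single i₀ 1) x)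
      (s • Matrix.vecMulVec x (Pi.single j₀ 1))) ⟨fun i => ?_, fun j => ?_⟩ ?_ ?_
    · rw [real_inner_comm, inner_hessian_risk, factorA_ofFactors, factorB_ofFactors] at h1
      have h2 := nonneg_of_mul_nonneg_right h1 hc2
      rw [Matrix.smul_mul, Matrix.mul_smul, Matrix.vecMulVec_mul, Matrix.mul_vecMulVec,
        ← Matrix.mulVec_transpose, Matrix.smul_mul, Matrix.mul_smul,
        Matrix.vecMulVec_mul_vecMulVec, frob_add_right (residualMatrix S M θc), frob_smul_right,
        frob_smul_right, Matrix.vecMulVec_smul, frob_smul_right, frob_vecMulVec] at h2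
      linarith
    · have : factorA (ofFactors (r • Matrix.vecMulVec (Pi.single i₀ 1) x)
          (s • Matrix.vecMulVec x (Pi.single j₀ 1))) i =
          r • ((Pi.single i₀ 1 : Fin d → ℝ) i • x) := rfl
      rw [this]
      exact U.smul_mem r (U.smul_mem _ hx)
    · have : (factorB (ofFactors (r • Matrix.vecMulVec (Pi.single i₀ 1) x)
          (s • Matrix.vecMulVec x (Pi.single j₀ 1))))ᵀ j =
          s • ((Pi.single j₀ 1 : Fin d → ℝ) j • x) := by
        funext l
        simp [Matrix.vecMulVec_apply, mul_comm]
      rw [this]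
      exact U.smul_mem s (U.smul_mem _ hx)
    · intro i hi
      have : i ≠ i₀ := fun h => hi (h ▸ hi₀)
      funext l
      simp [Matrix.vecMulVec_apply, this]
    · intro j hj
      have : j ≠ j₀ := fun h => hj (h ▸ hj₀)
      funext l
      simp [Matrix.vecMulVec_apply, this]
  -- If one factor kills `x`, its parameter drops out of the square and the form is affine in it;
  -- being nonnegative, it has zero slope. The halves cancel the factor 2 of the cross term.
  have key : (x ⬝ᵥ x) * residualMatrix S M θc i₀ j₀ = 0 := by
    rcases h0 with h0 | h0
    · refine eq_zero_of_forall_add_mul_nonneg (a := frob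
        (observed S (Matrix.vecMulVec (Pi.single i₀ 1) ((factorB θc)ᵀ *ᵥ x)))
        (Matrix.vecMulVec (Pi.single i₀ 1) ((factorB θc)ᵀ *ᵥ x))) fun s => ?_
      have h1 := hquad 1 (s / 2)
      rw [h0, Matrix.zero_vecMulVec, smul_zero, add_zero, one_smul] at h1
      linarith
    · refine eq_zero_of_forall_add_mul_nonneg (a := frob
        (observed S (Matrix.vecMulVec (factorA θc *ᵥ x) (Pi.single j₀ 1)))
        (Matrix.vecMulVec (factorA θc *ᵥ x) (Pi.single j₀ 1))) fun s => ?_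
      have h1 := hquad (s / 2) 1
      rw [h0, Matrix.vecMulVec_zero, smul_zero, zero_add, one_smul] at h1
      linarith
  exact dotProduct_self_eq_zero.1 ((mul_eq_zero.1 key).resolve_right hres)

theorem exists_ne_zero_forall_dotProduct_eq_zero {U : Submodule ℝ (Fin d → ℝ)} (hU : U < ⊤) :
    ∃ w : Fin d → ℝ, w ≠ 0 ∧ ∀ x ∈ U, x ⬝ᵥ w = 0 := by
  obtain ⟨f, hf, hker⟩ := Submodule.exists_le_ker_of_lt_top U hU
  have hfx : ∀ x, f x = x ⬝ᵥ fun i => f (Pi.single i 1) := fun x => by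
    rw [LinearMap.pi_apply_eq_sum_univ f x]
    simp only [dotProduct, smul_eq_mul]
    refine Finset.sum_congr rfl fun i _ => ?_
    congr 3
    funext j
    simp [Pi.single_apply, eq_comm]
  refine ⟨fun i => f (Pi.single i 1), fun h => hf ?_, fun x hx => ?_⟩
  · ext i
    simpa using congrFun h i
  · rw [← hfx]
    exact hker hx

end Invariance

/-! ### Assembly of the main theorem. -/

section Main

variable {d k : ℕ} {S : Finset (Fin d × Fin d)} {M : Matrix (Fin d) (Fin d) ℝ} {θc : Param d}

theorem rankOneParam_mem_rowsIn {p q w : Fin d → ℝ} {U : Submodule ℝ (Fin d → ℝ)} (hw : w ∈ U) :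
    rankOneParam p q w ∈ rowsIn U := by
  refine ⟨fun i => U.smul_mem (p i) hw, fun j => ?_⟩
  have : (factorB (rankOneParam p q w))ᵀ j = q j • w := by
    funext l
    simp [rankOneParam, Matrix.vecMulVec_apply, mul_comm]
  rw [this]
  exact U.smul_mem _ hw

theorem mem_of_rankOneParam_mem_rowsIn {p q w : Fin d → ℝ} {U : Submodule ℝ (Fin d → ℝ)}
    (hp : p ≠ 0) (h : rankOneParam p q w ∈ rowsIn U) : w ∈ U := by
  obtain ⟨i, hi⟩ := Function.ne_iff.1 hp
  have h1 : p i • w ∈ U := h.1 i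
  exact (U.smul_mem_iff hi).1 h1

theorem augMatrix_rankOneParam (p q w : Fin d → ℝ) :
    augMatrix (rankOneParam p q w) = Matrix.vecMulVec (Sum.elim p q) w := by
  ext s l
  rcases s with i | j
  · rfl
  · exact mul_comm _ _

theorem continuous_factorA : Continuous (factorA : Param d → Matrix (Fin d) (Fin d) ℝ) := by
  unfold factorA
  fun_prop

theorem continuous_factorB : Continuous (factorB : Param d → Matrix (Fin d) (Fin d) ℝ) := by
  unfold factorB
  fun_prop

/-- At a critical point the rows of the factors are orthogonal to the singular vectors of the
residual. -/
theorem vecMul_factors_eq_zero {σ : ℝ} {p q : Fin d → ℝ} (hσ : 0 < σ) (hS : S.Nonempty)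
    (hcrit : gradient (risk S M) θc = 0) (hq : residualMatrix S M θc *ᵥ q = -(σ • p))
    (hp : (residualMatrix S M θc)ᵀ *ᵥ p = -(σ • q)) :
    p ᵥ* factorA θc = 0 ∧ q ᵥ* (factorB θc)ᵀ = 0 := by
  have hc : (2 / (S.card : ℝ)) ≠ 0 := by
    have : (0 : ℝ) < S.card := by exact_mod_cast hS.card_pos
    positivity
  rw [gradient_risk, riskGrad, smul_eq_zero, or_iff_right hc] at hcrit
  have hA : residualMatrix S M θc * (factorB θc)ᵀ = 0 := congrArg factorA hcrit
  have hB : (factorA θc)ᵀ * residualMatrix S M θc = 0 := congrArg factorB hcrit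
  constructor
  · have h : (factorA θc)ᵀ *ᵥ (residualMatrix S M θc *ᵥ q) = 0 := by
      rw [Matrix.mulVec_mulVec, hB, Matrix.zero_mulVec]
    rw [hq, Matrix.mulVec_neg, Matrix.mulVec_smul, neg_eq_zero, smul_eq_zero,
      or_iff_right hσ.ne', Matrix.mulVec_transpose] at h
    exact h
  · have h : factorB θc *ᵥ ((residualMatrix S M θc)ᵀ *ᵥ p) = 0 := by
      rw [Matrix.mulVec_mulVec]
      have : factorB θc * (residualMatrix S M θc)ᵀ = 0 := by
        rw [← Matrix.transpose_transpose (factorB θc), ← Matrix.transpose_mul, hA,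
          Matrix.transpose_zero]
      rw [this, Matrix.zero_mulVec]
    rw [hp, Matrix.mulVec_neg, Matrix.mulVec_smul, neg_eq_zero, smul_eq_zero,
      or_iff_right hσ.ne'] at h
    rw [Matrix.vecMul_transpose, h]

theorem fderiv_neg_gradient (θ : Param d) :
    fderiv ℝ (fun x => -gradient (risk S M) x) θ = -hessian (risk S M) θ :=
  fderiv_fun_neg

/-- The top eigenvalue of `-∇²R` at a point whose rows and columns span a proper subspace. -/
theorem topEigenvalue_neg_hessian {σ lam : ℝ} {p q w₀ : Fin d → ℝ} (hS : S.Nonempty)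
    (hpsd : (σ • 1 - dilation (residualMatrix S M θc)).PosSemidef)
    (hev : (-hessian (risk S M) θc) (rankOneParam p q w₀) =
      (2 / (S.card : ℝ) * σ) • rankOneParam p q w₀) (hne : rankOneParam p q w₀ ≠ 0)
    (hlam : IsTopEigenvalue (-hessian (risk S M) θc) lam) : lam = 2 / (S.card : ℝ) * σ := by
  obtain ⟨v, hv⟩ := hlam.1.exists_hasEigenvector
  refine le_antisymm (le_of_hasEigenvector_neg_hessian hS hpsd hv.apply_eq_smul hv.2) ?_
  exact hlam.2 (Module.End.hasEigenvalue_of_hasEigenvector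
    ⟨Module.End.mem_eigenspace_iff.2 hev, hne⟩)

theorem tendsto_log_div {lam : ℝ} (hlam : 0 < lam) :
    Tendsto (fun a : ℝ => 1 / lam * Real.log a) (𝓝[>] 0) atBot :=
  Real.tendsto_log_nhdsGT_zero.const_mul_atBot (by positivity)

/-- Substitute σ = (log a)/λ, which tends to `-∞` as `a → 0⁺` and satisfies `e^{λσ} = a`. -/
theorem tendsto_rescaled_flow {E : Type*} [NormedAddCommGroup E] [InnerProductSpace ℝ E]
    {φ : E → ℝ → E} {c θ y : E} {lam t : ℝ} (hlam : 0 < lam)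
    (h : Tendsto (fun σ => φ (c + Real.exp (lam * σ) • θ) (t - σ)) atBot (𝓝 y)) :
    Tendsto (fun a : ℝ => φ (c + a • θ) (t + 1 / lam * Real.log (1 / a))) (𝓝[>] 0) (𝓝 y) := by
  refine (h.comp (tendsto_log_div hlam)).congr' ?_
  filter_upwards [self_mem_nhdsWithin] with a ha
  have h1 : lam * (1 / lam * Real.log a) = Real.log a := by field_simp
  rw [Function.comp_apply, h1, Real.exp_log ha, one_div a, Real.log_inv]
  congr 1
  ring

end Main

theorem mainTheorem1 {d k : ℕ} (hk : k < d)
    (S : Finset (Fin d × Fin d)) (M : Matrix (Fin d) (Fin d) ℝ)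
    (Ω : Set (Param d)) (hΩ : IsRankInvariantManifold S k Ω)
    (θc : Param d) (hθc : θc ∈ Ω)
    (htop : UniqueTopSingularValue (residualMatrix S M θc))
    (hsos : IsSecondOrderStationaryWithin (risk S M) Ω θc)
    (lam : ℝ) (hlam : IsTopEigenvalue (-hessian (risk S M) θc) lam) :
    (∀ θ₀ : Param d, IsGradientFlowFrom (risk S M) θ₀ (gradFlow (risk S M) θ₀)) ∧
    ∀ᵐ θ₀ : Param d ∂(volume : Measure (Param d)), ∃ z : ℝ → Param d,
      (∀ t : ℝ, Tendsto
        (fun a : ℝ => gradFlow (risk S M) (θc + a • θ₀) (t + 1 / lam * Real.log (1 / a)))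
        (𝓝[>] 0) (𝓝 (z t))) ∧
      (∃ β : Fin (k + 1) → Fin d → ℝ, LinearIndependent ℝ β ∧ ∀ t : ℝ, z t ∈ Omega β) ∧
      (∀ t : ℝ, (augMatrix (z t)).rank = (augMatrix θc).rank + 1) ∧
      (∀ᶠ t : ℝ in atBot, (factorA (z t)).rank = (factorA θc).rank + 1 ∧
        (factorB (z t)).rank = (factorB θc).rank + 1) := by
  have hflow := isGradientFlowFrom_gradFlow (contDiff_risk S M) (risk_nonneg S M)
  have hφ := isSemiflow_gradFlow (contDiff_risk S M) (risk_nonneg S M)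
  refine ⟨hflow, ?_⟩
  obtain ⟨α, I, J, hα, hIJ, hΩ⟩ := hΩ.exists_block
  obtain ⟨hcα, hcA, hcB⟩ := (hΩ θc).1 hθc
  obtain ⟨hcrit, hsos⟩ := hsos
  obtain ⟨σ, p, q, hσ, hpsd, hp0, hq0, hDq, hDp, hone⟩ := exists_top_singular_vector htop
  have hS : S.Nonempty := nonempty_of_residualMatrix_mulVec hσ hp0 hDq
  set U := Submodule.span ℝ (Set.range α) with hU
  have hUtop : U < ⊤ := by
    refine lt_top_iff_ne_top.2 fun h => ?_
    have h1 := finrank_span_eq_card hα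
    rw [← hU, h, finrank_top, Module.finrank_fintype_fun_eq_card, Fintype.card_fin,
      Fintype.card_fin] at h1
    omega
  obtain ⟨w₀, hw₀, hperp⟩ := exists_ne_zero_forall_dotProduct_eq_zero hUtop
  have hw₀U : w₀ ∉ U := fun h => hw₀ (dotProduct_self_eq_zero.1 (hperp w₀ h))
  have hev := hessian_rankOneParam (w := w₀) hDq hDp (funext fun i => hperp _ (hcα.1 i))
    (funext fun j => (dotProduct_comm _ _).trans (hperp _ (hcα.2 j)))
  have hv₀ : rankOneParam p q w₀ ∉ rowsIn U := fun h => hw₀U (mem_of_rankOneParam_mem_rowsIn hp0 h)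
  have hlam_eq := topEigenvalue_neg_hessian hS hpsd hev
    (fun h => hv₀ (h ▸ Submodule.zero_mem _)) hlam
  have hlam_pos : 0 < lam := by
    have : (0 : ℝ) < S.card := by exact_mod_cast hS.card_pos
    rw [hlam_eq]
    positivity
  obtain ⟨μ, hW⟩ := exists_isTopSpectralSplit (isSymmetric_hessian_risk S M θc) hlam_pos hlam
  set W := Module.End.eigenspace
    ((-hessian (risk S M) θc : Param d →L[ℝ] Param d) : Param d →ₗ[ℝ] Param d) lam with hW_def
  rw [← fderiv_neg_gradient] at hW
  have hg : ∀ {n : WithTop ℕ∞}, ContDiff ℝ n fun x => -gradient (risk S M) x :=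
    (contDiff_gradient (contDiff_risk S M)).neg
  -- The exceptional initial directions are those whose projection to `W` brings no new row
  -- direction. They form a linear subspace, proper because it misses `rankOneParam p q w₀`.
  have hbad : (rowsIn U).comap (W.starProjection : Param d →ₗ[ℝ] Param d) ≠ ⊤ := by
    intro h
    have h1 : rankOneParam p q w₀ ∈
        (rowsIn U).comap (W.starProjection : Param d →ₗ[ℝ] Param d) := h ▸ Submodule.mem_top
    rw [Submodule.mem_comap, ContinuousLinearMap.coe_coe, Submodule.starProjection_eq_self_iff.2
      (Module.End.mem_eigenspace_iff.2 (hlam_eq ▸ hev))] at h1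
    exact hv₀ h1
  filter_upwards [measure_eq_zero_iff_ae_notMem.1 (Measure.addHaar_submodule volume _ hbad)]
    with θ₀ hθ₀
  obtain ⟨z, hz, hz', hzφ, hzas⟩ := hφ.exists_escape_limit hg (by simp [hcrit]) hW θ₀
  obtain ⟨w, hw⟩ := exists_eq_rankOneParam hS hpsd hone (v := W.starProjection θ₀)
    (hlam_eq ▸ Module.End.mem_eigenspace_iff.1 (W.starProjection_apply_mem θ₀))
  have hwU : w ∉ U := fun h => hθ₀ (by
    change W.starProjection θ₀ ∈ rowsIn U
    rw [hw]
    exact rankOneParam_mem_rowsIn h)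
  rw [hw] at hz' hzas
  -- Releasing along the projection of `θ₀` instead of `θ₀` gives the same limit but starts inside
  -- `c + V`, which is closed and invariant.
  have hzmem : ∀ (V : Submodule ℝ (Param d)) (c : Param d),
      (∀ v ∈ V, -gradient (risk S M) (c + v) ∈ V) → θc - c ∈ V → rankOneParam p q w ∈ V →
      ∀ t, z t - c ∈ V := by
    intro V c hV h1 h2 t
    refine V.closed_of_finiteDimensional.mem_of_tendsto ((hz' t).sub_const c) ?_
    filter_upwards [eventually_le_atBot t] with s hs
    refine (hφ.sub_mem_iff hg hV _ (sub_nonneg.2 hs)).2 ?_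
    rw [add_sub_right_comm]
    exact V.add_mem h1 (V.smul_mem _ h2)
  have hzrows : ∀ V : Submodule ℝ (Fin d → ℝ), θc ∈ rowsIn V → w ∈ V → ∀ t, z t ∈ rowsIn V := by
    intro V h1 h2 t
    have := hzmem (rowsIn V) 0 (fun v hv => by rw [zero_add]; exact neg_gradient_mem_rowsIn hv)
      (by rwa [sub_zero]) (rankOneParam_mem_rowsIn h2) t
    rwa [sub_zero] at this
  have hβ : LinearIndependent ℝ (Fin.cons w α : Fin (k + 1) → Fin d → ℝ) :=
    linearIndependent_finCons.2 ⟨hα, hwU⟩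
  have hUβ : U ≤ Submodule.span ℝ (Set.range (Fin.cons w α : Fin (k + 1) → Fin d → ℝ)) := by
    rw [Fin.range_cons]
    exact Submodule.span_mono (Set.subset_insert _ _)
  have hzβ : ∀ t, z t ∈ rowsIn (Submodule.span ℝ
      (Set.range (Fin.cons w α : Fin (k + 1) → Fin d → ℝ))) :=
    hzrows _ ⟨fun i => hUβ (hcα.1 i), fun j => hUβ (hcα.2 j)⟩ (Submodule.subset_span ⟨0, rfl⟩)
  obtain ⟨hpA, hqB⟩ := vecMul_factors_eq_zero hσ hS hcrit hDq hDp
  have hzc : Tendsto z atBot (𝓝 θc) := by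
    have h1 : Tendsto (fun t => Real.exp (lam * t)) atBot (𝓝 0) :=
      Real.tendsto_exp_atBot.comp (tendsto_id.const_mul_atBot hlam_pos)
    have h2 := (h1.smul hzas).add_const θc
    rw [zero_smul, zero_add] at h2
    refine h2.congr fun t => ?_
    rw [smul_smul, ← Real.exp_add, add_neg_cancel, Real.exp_zero, one_smul, sub_add_cancel]
  have hwX : ∀ {m : Type} {X : Matrix m (Fin d) ℝ}, (∀ i, X i ∈ U) →
      w ∉ Submodule.span ℝ (Set.range X.row) := fun h hmem =>
    hwU (Submodule.span_le.2 (Set.range_subset_iff.2 h) hmem)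
  have hAlow : ∀ᶠ t in atBot, (factorA θc).rank + 1 ≤ (factorA (z t)).rank :=
    eventually_rank_add_one_le ((continuous_factorA.tendsto _).comp hzc)
      ((continuous_factorA.tendsto _).comp hzas) hpA hp0 (hwX hcα.1)
  have hBlow : ∀ᶠ t in atBot, (factorB θc)ᵀ.rank + 1 ≤ (factorB (z t))ᵀ.rank := by
    have hcont : Continuous fun θ : Param d => (factorB θ)ᵀ := continuous_factorB.matrix_transpose
    refine eventually_rank_add_one_le (ε := fun t => Real.exp (-(lam * t))) (u := q) (w := w)
      ((hcont.tendsto _).comp hzc) ?_ hqB hq0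
      (hwX hcα.2)
    have h1 := (hcont.tendsto _).comp hzas
    rw [rankOneParam, factorB_ofFactors, Matrix.transpose_vecMulVec] at h1
    exact h1
  have hauglow : ∀ᶠ t in atBot, (augMatrix θc).rank + 1 ≤ (augMatrix (z t)).rank := by
    have hcont : Continuous fun θ : Param d => augMatrix θ := by
      refine continuous_pi fun s => ?_
      rcases s with i | j
      · exact (continuous_apply i).comp continuous_factorA
      · exact (continuous_apply j).comp continuous_factorB.matrix_transpose
    refine eventually_rank_add_one_le (ε := fun t => Real.exp (-(lam * t))) (u := Sum.elim p q)
      (w := w) ((hcont.tendsto _).comp hzc)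
      ?_ ?_ (fun h => hp0 (funext fun i => congrFun h (Sum.inl i)))
      (hwX (augMatrix_mem_of_mem_rowsIn hcα))
    · have h1 := (hcont.tendsto _).comp hzas
      rw [augMatrix_rankOneParam] at h1
      refine h1.congr fun t => ?_
      ext s l
      rcases s with i | j <;> rfl
    · rw [augMatrix, Matrix.vecMul_fromRows]
      simp [hpA, hqB]
  refine ⟨z, fun t => tendsto_rescaled_flow hlam_pos (hz t), ⟨_, hβ, hzβ⟩, fun t => ?_, ?_⟩
  · refine le_antisymm (rank_le_rank_add_one (w := w) (augMatrix_mem_of_mem_rowsIn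
      (hzrows _ ?_ ?_ t))) ?_
    · have h1 := mem_rowsIn_span_augMatrix θc
      exact ⟨fun i => Submodule.mem_sup_left (h1.1 i), fun j => Submodule.mem_sup_left (h1.2 j)⟩
    · exact Submodule.mem_sup_right (Submodule.mem_span_singleton_self w)
    -- Backward invariance of the row space at time `t` places the rows at an earlier time `s`
    -- inside it, so the rank at `t` is at least the rank already gained at `s`.
    · obtain ⟨s, hs, hst⟩ := (hauglow.and (eventually_le_atBot t)).exists
      refine hs.trans ?_
      have h1 := mem_rowsIn_span_augMatrix (z t)
      have h2 := (hφ.sub_mem_iff hg (V := rowsIn (Submodule.span ℝ (Set.range (augMatrix (z t)).row)))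
        (c := 0) (fun v hv => by rw [zero_add]; exact neg_gradient_mem_rowsIn hv) (z s)
        (sub_nonneg.2 hst)).1 (by rwa [sub_zero, ← hzφ s t hst])
      rw [sub_zero] at h2
      rw [(augMatrix (z s)).rank_eq_finrank_span_row, (augMatrix (z t)).rank_eq_finrank_span_row]
      exact Submodule.finrank_mono (Submodule.span_le.2 (Set.range_subset_iff.2
        (augMatrix_mem_of_mem_rowsIn h2)))
  · have hup : ∀ t, (factorA (z t)).rank ≤ (factorA θc).rank + 1 ∧
        (factorB (z t))ᵀ.rank ≤ (factorB θc)ᵀ.rank + 1 := by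
      intro t
      -- A nonzero residual on the block gives both factors rank at least `k` at `θc`, while `z t`
      -- has row space of dimension at most `k + 1`.
      by_cases hres : ∃ i ∈ I, ∃ j ∈ J, residualMatrix S M θc i j ≠ 0
      · obtain ⟨i₀, hi₀, j₀, hj₀, hne⟩ := hres
        have hinj := fun x (hx : x ∈ U) => injOn_span_of_residual_ne_zero hi₀ hj₀ hne hS
          (fun v hv hvA hvB => hsos v ((hΩ v).2 ⟨hv, hvA, hvB⟩)) hx
        have hle : ∀ {X : Matrix (Fin d) (Fin d) ℝ}, (∀ i, X i ∈ Submodule.span ℝ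
            (Set.range (Fin.cons w α : Fin (k + 1) → Fin d → ℝ))) → X.rank ≤ k + 1 := by
          intro X hX
          rw [X.rank_eq_finrank_span_row]
          refine (Submodule.finrank_mono (Submodule.span_le.2 (Set.range_subset_iff.2 hX))).trans ?_
          exact (finrank_range_le_card _).trans (Fintype.card_fin _).le
        exact ⟨(hle (hzβ t).1).trans (Nat.succ_le_succ
            (le_rank_of_injOn hα fun x hx h => hinj x hx (Or.inl h))),
          (hle (hzβ t).2).trans (Nat.succ_le_succ
            (le_rank_of_injOn hα fun x hx h => hinj x hx (Or.inr h)))⟩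
      · push Not at hres
        -- With no residual on the block, the top singular vectors live off it, so the escape
        -- direction and the whole trajectory stay in `θc + offBlockMultiples I J w`.
        have hzero : ∀ i j, (i ∈ I ∨ j ∈ J) → residualMatrix S M θc i j = 0 := by
          intro i j h
          by_cases hij : (i, j) ∈ S
          · have := hIJ i j hij
            exact hres i (by tauto) j (by tauto)
          · simp [residualMatrix, hij]
        have hpI : ∀ i ∈ I, p i = 0 := by
          intro i hi
          have h1 := congrFun hDq i
          rw [Matrix.mulVec, dotProduct, Finset.sum_eq_zero fun j _ => by
            rw [hzero i j (Or.inl hi), zero_mul]] at h1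
          simpa [hσ.ne'] using h1
        have hqJ : ∀ j ∈ J, q j = 0 := by
          intro j hj
          have h1 := congrFun hDp j
          rw [Matrix.mulVec, dotProduct, Finset.sum_eq_zero fun i _ => by
            rw [Matrix.transpose_apply, hzero i j (Or.inr hj), zero_mul]] at h1
          simpa [hσ.ne'] using h1
        have hv := (hzmem (offBlockMultiples I J w) θc
          (fun v hv => neg_gradient_mem_offBlockMultiples hIJ hcA hcB hres hv)
          (by rw [sub_self]; exact Submodule.zero_mem _)
          ⟨⟨fun i hi => by
              funext l
              simp [rankOneParam, Matrix.vecMulVec_apply, hpI i hi],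
            fun j hj => by
              funext l
              simp [rankOneParam, Matrix.vecMulVec_apply, hqJ j hj]⟩,
            rankOneParam_mem_rowsIn (Submodule.mem_span_singleton_self w)⟩ t).2
        have hzt : z t = θc + (z t - θc) := by abel
        constructor
        · refine rank_le_rank_add_one (w := w) fun i => ?_
          rw [hzt, factorA_add_row]
          exact Submodule.add_mem_sup (Submodule.subset_span ⟨i, rfl⟩) (hv.1 i)
        · refine rank_le_rank_add_one (w := w) fun j => ?_
          rw [hzt, factorB_add_col]
          exact Submodule.add_mem_sup (Submodule.subset_span ⟨j, rfl⟩) (hv.2 j)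
    filter_upwards [hAlow, hBlow] with t hA hB
    rw [← Matrix.rank_transpose (factorB (z t)), ← Matrix.rank_transpose (factorB θc)]
    exact ⟨le_antisymm (hup t).1 hA, le_antisymm (hup t).2 hB⟩

end
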